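/- Conventions. Fix an infinite-dimensional separable complex Hilbert space $\mathscr H$; let $\mathfrak K$ be the compact operators on $\mathscr H$ and $\mathfrak K_1$ its closed unit ball. A metric space is proper if its closed bounded subsets are compact. It has bounded geometry if it contains a subset $\Gamma$ such that (i) for some $C>0$ every point of the space is within distance $C$ of $\Gamma$, (ii) for some $c>0$ any two distinct points of $\Gamma$ are at distance at least $c$, and (iii) for every $R\ge 0$ there is $N\in\mathbb N$ with $\#(B(x,R)\cap\Gamma)\le N$ for all $x\in\Gamma$. A map $f:X\to Y$ is coarse if preimages of bounded sets are bounded and there is a non-decreasing $\rho_+:[0,\infty)\to[0,\infty)$ with $d(f(x),f(x'))\le\rho_+(d(x,x'))$ for all $x,x'\in X$. The spaces $X$ and $Y$ are coarsely equivalent if there are coarse maps $f:X\to Y$ and $g:Y\to X$ such that $\sup_y d(f(g(y)),y)$ and $\sup_x d(g(f(x)),x)$ are finite. An ample module of a proper metric space $X$ is a non-degenerate $*$-representation $\rho$ of $C_0(X)$ on an infinite-dimensional separable Hilbert space $\mathcal H_X$ such that $\rho(f)$ is not compact for any non-zero $f\in C_0(X)$. Write $\chi_E$, for $E\subseteq X$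 Borel, for the projections given by the extension of $\rho$ to bounded Borel functions. An operator $T$ on $\mathcal H_X$ is locally compact if $\rho(f)T$ and $T\rho(f)$ are compact for all $f\in C_0(X)$. A map $g:X\to\mathfrak K$ is countably-valued if it is constant, with value $a_n$, on each set $E_n$ of some countable Borel partition $(E_n)$ of $X$, and strongly measurable if it is a pointwise limit of a sequence of countably-valued maps. For a bounded countably-valued $g$, let $\Lambda(g)$ be the operator on $\mathcal H_X\otimes\mathscr H$ that is block-diagonal for the decomposition $\bigoplus_n \chi_{E_n}\mathcal H_X\otimes\mathscr H$ and equals $1\otimes a_n$ on the $n$-th block; for a bounded strongly measurable $g$, let $\Lambda(g)$ be the norm limit of $\Lambda(g_k)$, where the $g_k$ are countably-valued and converge to $g$ uniformly. A map $g$ has $(\delta,R)$-variation if $\|g(x)-g(y)\|<\delta$ whenever $d(x,y)<R$. An operator $T$ on $\mathcal H_X$ is strongly quasi-local if for every $\varepsilon>0$ there are $\delta,R>0$ such that $\|[T\otimes 1_{\mathscr H},\Lambda(g)]\|<\varepsilon$ for every strongly measurable $g:X\to\mathfrak K_1$ with $(\delta,R)$-variation. Let $C^*_{sq}(\mathcal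 H_X)$ be the $*$-algebra (in fact a $C^*$-algebra) of all locally compact, strongly quasi-local operators on $\mathcal H_X$. Corollary. Let $X$ and $Y$ be proper metric spaces of bounded geometry, and let $\mathcal H_X$ and $\mathcal H_Y$ be ample modules of $X$ and $Y$, respectively. If $X$ and $Y$ are coarsely equivalent, then $C^*_{sq}(\mathcal H_X)$ and $C^*_{sq}(\mathcal H_Y)$ are $*$-isomorphic. In particular, for a proper metric space $X$ of bounded geometry, any two ample $X$-modules $\mathcal H_X$ and $\mathcal H_X'$ have $*$-isomorphic algebras $C^*_{sq}(\mathcal H_X)\cong C^*_{sq}(\mathcal H_X')$. -/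

import Mathlib

open Set Filter Topology UniformSpace
open scoped TensorProduct ZeroAtInfty NNReal InnerProductSpace

set_option linter.unusedSectionVars false

noncomputable section

namespace StrongQuasiLocal

/-! ## Coarse geometry -/

section Coarse

variable {X Y : Type*} [MetricSpace X] [MetricSpace Y]

/-- `Γ` is a net in `X`. -/
def IsNet (Γ : Set X) : Prop :=
  ∃ C : ℝ, 0 < C ∧ ∀ x : X, ∃ y ∈ Γ, dist x y ≤ C

/-- `Γ` is uniformly discrete. -/
def IsUniformlyDiscrete (Γ : Set X) : Prop :=
  ∃ C : ℝ, 0 < C ∧ ∀ x ∈ Γ, ∀ y ∈ Γ, x ≠ y → C ≤ dist x y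

variable (X) in
/-- `X` contains a uniformly discrete net, the number of whose points in a ball centred at
a point of the net is bounded in terms of the radius only. -/
def HasBoundedGeometry : Prop :=
  ∃ Γ : Set X, IsNet Γ ∧ IsUniformlyDiscrete Γ ∧
    ∀ R : ℝ, 0 ≤ R → ∃ N : ℕ, ∀ x ∈ Γ, (Metric.ball x R ∩ Γ).encard ≤ N

/-- `f` is uniformly expansive. -/
def IsUniformlyExpansive (f : X → Y) : Prop :=
  ∃ ρ : ℝ≥0 → ℝ≥0, Monotone ρ ∧ ∀ x y : X, nndist (f x) (f y) ≤ ρ (nndist x y)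

/-- Preimages of bounded sets are bounded. -/
def IsMetricallyProper (f : X → Y) : Prop :=
  ∀ B : Set Y, Bornology.IsBounded B → Bornology.IsBounded (f ⁻¹' B)

/-- `f` is a coarse map. -/
def IsCoarse (f : X → Y) : Prop :=
  IsUniformlyExpansive f ∧ IsMetricallyProper f

/-- Two maps are close. -/
def AreClose (f g : X → Y) : Prop :=
  ∃ R : ℝ, 0 ≤ R ∧ ∀ x : X, dist (f x) (g x) ≤ R

/-- `f` is a coarse equivalence. -/
def IsCoarseEquivalence (f : X → Y) : Prop :=
  IsCoarse f ∧ ∃ g : Y → X, IsCoarse g ∧ AreClose (f ∘ g) id ∧ AreClose (g ∘ f) id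

variable (X Y) in
/-- `X` and `Y` are coarsely equivalent. -/
def CoarselyEquivalent : Prop :=
  ∃ f : X → Y, IsCoarseEquivalence f

end Coarse

/-! ## Hilbert space tensor products -/

section Tensor

variable {H : Type*} [NormedAddCommGroup H] [InnerProductSpace ℂ H] [CompleteSpace H]
variable {K : Type*} [NormedAddCommGroup K] [InnerProductSpace ℂ K] [CompleteSpace K]

variable (H K) in
/-- The Hilbert space tensor product: the completion of the algebraic tensor product. -/
def HilbertTensor := Completion (H ⊗[ℂ] K)

instance : NormedAddCommGroup (HilbertTensor H K) :=
  inferInstanceAs (NormedAddCommGroup (Completion (H ⊗[ℂ] K)))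

instance : InnerProductSpace ℂ (HilbertTensor H K) :=
  inferInstanceAs (InnerProductSpace ℂ (Completion (H ⊗[ℂ] K)))

instance : CompleteSpace (HilbertTensor H K) :=
  inferInstanceAs (CompleteSpace (Completion (H ⊗[ℂ] K)))

/-- The isometric embedding of the algebraic tensor product, with dense range. -/
def toHilbertTensor : H ⊗[ℂ] K →ₗᵢ[ℂ] HilbertTensor H K :=
  Completion.toComplₗᵢ

theorem denseRange_toHilbertTensor : DenseRange (toHilbertTensor : H ⊗[ℂ] K → HilbertTensor H K) :=
  Completion.denseRange_coe

theorem inner_map_map_adjoint (A : H →L[ℂ] H) (B : K →L[ℂ] K) (z w : H ⊗[ℂ] K) :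
    inner ℂ (TensorProduct.map (A : H →ₗ[ℂ] H) (B : K →ₗ[ℂ] K) z) w =
      inner ℂ z (TensorProduct.map ((star A : H →L[ℂ] H) : H →ₗ[ℂ] H)
        ((star B : K →L[ℂ] K) : K →ₗ[ℂ] K) w) := by
  induction z with
  | zero => simp
  | add x y hx hy => simp only [map_add, inner_add_left, hx, hy]
  | tmul a b =>
    induction w with
    | zero => simp
    | add x y hx hy => simp only [map_add, inner_add_right, hx, hy]
    | tmul c d =>
      simp [ContinuousLinearMap.star_eq_adjoint, ContinuousLinearMap.adjoint_inner_right]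

theorem norm_map_id_le (A : H →L[ℂ] H) (z : H ⊗[ℂ] K) :
    ‖TensorProduct.map (A : H →ₗ[ℂ] H) ((1 : K →L[ℂ] K) : K →ₗ[ℂ] K) z‖ ≤ ‖A‖ * ‖z‖ := by
  have h0 : (0 : H →L[ℂ] H) ≤ algebraMap ℝ (H →L[ℂ] H) (‖A‖ ^ 2) - star A * A :=
    sub_nonneg.mpr CStarAlgebra.star_mul_le_algebraMap_norm_sq
  obtain ⟨R, hR⟩ := CStarAlgebra.nonneg_iff_eq_star_mul_self.mp h0
  set TA := TensorProduct.map (A : H →ₗ[ℂ] H) ((1 : K →L[ℂ] K) : K →ₗ[ℂ] K) z with hTA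
  set TR := TensorProduct.map (R : H →ₗ[ℂ] H) ((1 : K →L[ℂ] K) : K →ₗ[ℂ] K) z with hTR
  have key : ∀ B : H →L[ℂ] H,
      inner ℂ (TensorProduct.map (B : H →ₗ[ℂ] H) ((1 : K →L[ℂ] K) : K →ₗ[ℂ] K) z)
        (TensorProduct.map (B : H →ₗ[ℂ] H) ((1 : K →L[ℂ] K) : K →ₗ[ℂ] K) z) =
      inner ℂ z (TensorProduct.map ((star B * B : H →L[ℂ] H) : H →ₗ[ℂ] H)
        ((1 : K →L[ℂ] K) : K →ₗ[ℂ] K) z) := by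
    intro B
    rw [inner_map_map_adjoint, ← LinearMap.comp_apply, ← TensorProduct.map_comp, star_one]
    rfl
  have hsum : (TensorProduct.map ((star R * R : H →L[ℂ] H) : H →ₗ[ℂ] H)
        ((1 : K →L[ℂ] K) : K →ₗ[ℂ] K) z) +
      (TensorProduct.map ((star A * A : H →L[ℂ] H) : H →ₗ[ℂ] H)
        ((1 : K →L[ℂ] K) : K →ₗ[ℂ] K) z) = ((‖A‖ ^ 2 : ℝ) : ℂ) • z := by
    rw [← LinearMap.add_apply, ← TensorProduct.map_add_left, ← ContinuousLinearMap.toLinearMap_add, ← hR,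
      sub_add_cancel]
    have : ((algebraMap ℝ (H →L[ℂ] H) (‖A‖ ^ 2) : H →L[ℂ] H) : H →ₗ[ℂ] H) =
        ((‖A‖ ^ 2 : ℝ) : ℂ) • LinearMap.id := by
      ext x
      simp [Algebra.algebraMap_eq_smul_one]
      norm_cast
    rw [this, TensorProduct.map_smul_left]
    change ((‖A‖ ^ 2 : ℝ) : ℂ) • TensorProduct.map LinearMap.id LinearMap.id z = _
    rw [TensorProduct.map_id, LinearMap.id_apply]
  have h1 : inner ℂ TR TR + inner ℂ TA TA = ((‖A‖ ^ 2 : ℝ) : ℂ) * inner ℂ z z := by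
    rw [hTR, hTA, key, key]
    exact (inner_add_right z _ _).symm.trans
      ((congrArg (inner ℂ z) hsum).trans (inner_smul_right z z _))
  rw [inner_self_eq_norm_sq_to_K (𝕜 := ℂ) TR, inner_self_eq_norm_sq_to_K (𝕜 := ℂ) TA,
    inner_self_eq_norm_sq_to_K (𝕜 := ℂ) z] at h1
  have h2 : ‖TR‖ ^ 2 + ‖TA‖ ^ 2 = ‖A‖ ^ 2 * ‖z‖ ^ 2 := by
    apply Complex.ofReal_injective
    push_cast at h1 ⊢
    exact h1
  have h3 : ‖TA‖ ^ 2 ≤ (‖A‖ * ‖z‖) ^ 2 := by nlinarith [sq_nonneg ‖TR‖]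
  exact (sq_le_sq₀ (norm_nonneg _) (by positivity)).mp h3

theorem norm_id_map_le (B : K →L[ℂ] K) (z : H ⊗[ℂ] K) :
    ‖TensorProduct.map ((1 : H →L[ℂ] H) : H →ₗ[ℂ] H) (B : K →ₗ[ℂ] K) z‖ ≤ ‖B‖ * ‖z‖ := by
  have h := norm_map_id_le (K := H) B (TensorProduct.comm ℂ H K z)
  rw [TensorProduct.norm_comm, TensorProduct.map_comm, TensorProduct.norm_comm] at h
  exact h

theorem norm_map_le (A : H →L[ℂ] H) (B : K →L[ℂ] K) (z : H ⊗[ℂ] K) :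
    ‖TensorProduct.map (A : H →ₗ[ℂ] H) (B : K →ₗ[ℂ] K) z‖ ≤ ‖A‖ * ‖B‖ * ‖z‖ := by
  have h : TensorProduct.map (A : H →ₗ[ℂ] H) (B : K →ₗ[ℂ] K) z =
      TensorProduct.map (A : H →ₗ[ℂ] H) ((1 : K →L[ℂ] K) : K →ₗ[ℂ] K)
        (TensorProduct.map ((1 : H →L[ℂ] H) : H →ₗ[ℂ] H) (B : K →ₗ[ℂ] K) z) := by
    rw [← LinearMap.comp_apply, ← TensorProduct.map_comp]
    rfl
  rw [h]
  calc _ ≤ ‖A‖ * _ := norm_map_id_le A _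
    _ ≤ ‖A‖ * (‖B‖ * ‖z‖) := by gcongr; exact norm_id_map_le B z
    _ = _ := by ring

/-- The operator `A ⊗ B` on the Hilbert space tensor product. -/
def tensorOp (A : H →L[ℂ] H) (B : K →L[ℂ] K) : HilbertTensor H K →L[ℂ] HilbertTensor H K :=
  ((TensorProduct.map (A : H →ₗ[ℂ] H) (B : K →ₗ[ℂ] K)).mkContinuous (‖A‖ * ‖B‖)
    (norm_map_le A B)).completion

theorem tensorOp_coe (A : H →L[ℂ] H) (B : K →L[ℂ] K) (z : H ⊗[ℂ] K) :
    tensorOp A B (toHilbertTensor z) =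
      toHilbertTensor (TensorProduct.map (A : H →ₗ[ℂ] H) (B : K →ₗ[ℂ] K) z) :=
  ContinuousLinearMap.completion_apply_coe _ _

theorem tensorOp_ext {S T : HilbertTensor H K →L[ℂ] HilbertTensor H K}
    (h : ∀ z : H ⊗[ℂ] K, S (toHilbertTensor z) = T (toHilbertTensor z)) : S = T := by
  refine ContinuousLinearMap.ext fun z => ?_
  exact congrFun (denseRange_toHilbertTensor.equalizer S.continuous T.continuous
    (funext fun z => h z)) z

theorem tensorOp_mul (A A' : H →L[ℂ] H) (B B' : K →L[ℂ] K) :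
    tensorOp (A * A') (B * B') = tensorOp A B * tensorOp A' B' := by
  refine tensorOp_ext fun z => ?_
  rw [mul_apply_eq_comp, tensorOp_coe, tensorOp_coe, tensorOp_coe,
    ← LinearMap.comp_apply, ← TensorProduct.map_comp]
  rfl

theorem tensorOp_add (A A' : H →L[ℂ] H) (B : K →L[ℂ] K) :
    tensorOp (A + A') B = tensorOp A B + tensorOp A' B := by
  refine tensorOp_ext fun z => ?_
  rw [add_apply, tensorOp_coe, tensorOp_coe, tensorOp_coe,
    ContinuousLinearMap.toLinearMap_add, TensorProduct.map_add_left, LinearMap.add_apply,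
    map_add]

theorem tensorOp_smul (c : ℂ) (A : H →L[ℂ] H) (B : K →L[ℂ] K) :
    tensorOp (c • A) B = c • tensorOp A B := by
  refine tensorOp_ext fun z => ?_
  rw [smul_apply, tensorOp_coe, tensorOp_coe,
    ContinuousLinearMap.toLinearMap_smul, TensorProduct.map_smul_left, LinearMap.smul_apply,
    map_smul]

theorem tensorOp_star (A : H →L[ℂ] H) (B : K →L[ℂ] K) :
    tensorOp (star A) (star B) = star (tensorOp A B) := by
  rw [ContinuousLinearMap.star_eq_adjoint (tensorOp A B),
    ContinuousLinearMap.eq_adjoint_iff]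
  intro x y
  refine denseRange_toHilbertTensor.induction_on₂ (isClosed_eq (by fun_prop) (by fun_prop))
    (fun x y => ?_) x y
  rw [tensorOp_coe, tensorOp_coe, LinearIsometry.inner_map_map, LinearIsometry.inner_map_map,
    inner_map_map_adjoint, star_star, star_star]

end Tensor

/-! ## Compact operators -/

section Compact

variable {H : Type*} [NormedAddCommGroup H] [InnerProductSpace ℂ H] [CompleteSpace H]

theorem isCompactOperator_star {T : H →L[ℂ] H} (hT : IsCompactOperator T) :
    IsCompactOperator (star T : H →L[ℂ] H) := by
  have hTT : IsCompactOperator (T * star T : H →L[ℂ] H) := hT.comp_clm (star T)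
  have hball := hTT.isCompact_closure_image_closedBall (f := ((T * star T : H →L[ℂ] H) : H →ₗ[ℂ] H)) 1
  refine (isCompactOperator_iff_isCompact_closure_image_closedBall
    (f := ((star T : H →L[ℂ] H) : H →ₗ[ℂ] H)) one_pos).mpr ?_
  refine TotallyBounded.isCompact_of_isClosed ?_ isClosed_closure
  refine TotallyBounded.closure ?_
  have htb := hball.totallyBounded.subset subset_closure
  rw [Metric.totallyBounded_iff]
  intro ε hε
  obtain ⟨t, hts, htf, hcov⟩ := Metric.finite_approx_of_totallyBounded htb (ε ^ 2 / 2)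
    (by positivity)
  have hpre : ∀ y : H, ∃ x : H, y ∈ t → ‖x‖ ≤ 1 ∧ T (star T x) = y := by
    intro y
    by_cases hy : y ∈ t
    · obtain ⟨x, hx, hxy⟩ := hts hy
      exact ⟨x, fun _ => ⟨mem_closedBall_zero_iff.mp hx, hxy⟩⟩
    · exact ⟨0, fun h => absurd h hy⟩
  choose p hp using hpre
  refine ⟨(fun y => star T (p y)) '' t, htf.image _, ?_⟩
  rintro _ ⟨x, hx, rfl⟩
  have hx1 : ‖x‖ ≤ 1 := mem_closedBall_zero_iff.mp hx
  obtain ⟨y, hyt, hy⟩ := mem_iUnion₂.mp (hcov ⟨x, hx, rfl⟩)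
  refine mem_iUnion₂.mpr ⟨_, ⟨y, hyt, rfl⟩, ?_⟩
  obtain ⟨hp1, hp2⟩ := hp y hyt
  have hy' : ‖T (star T (x - p y))‖ < ε ^ 2 / 2 := by
    rw [map_sub, map_sub, hp2, ← dist_eq_norm]
    exact hy
  have hd : ‖x - p y‖ ≤ 2 := (norm_sub_le _ _).trans (by linarith)
  have hsq : ‖star T (x - p y)‖ ^ 2 ≤ ‖x - p y‖ * ‖T (star T (x - p y))‖ := by
    rw [← inner_self_eq_norm_sq (𝕜 := ℂ), ContinuousLinearMap.star_eq_adjoint,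
      ContinuousLinearMap.adjoint_inner_left]
    exact (RCLike.re_le_norm _).trans (norm_inner_le_norm _ _)
  have hlt : ‖star T (x - p y)‖ ^ 2 < ε ^ 2 := by
    nlinarith [norm_nonneg (T (star T (x - p y)))]
  change dist (star T x) (star T (p y)) < ε
  rw [dist_eq_norm, ← map_sub]
  exact lt_of_pow_lt_pow_left₀ 2 hε.le hlt

variable (H) in
/-- The compact operators on `H`. -/
abbrev Compacts := ↥(compactOperator (RingHom.id ℂ) H H)

instance : Star (Compacts H) where
  star a := ⟨star (a : H →L[ℂ] H), isCompactOperator_star a.2⟩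

theorem coe_star_compacts (a : Compacts H) : ((star a : Compacts H) : H →L[ℂ] H) = star a.1 := rfl

theorem star_star_compacts (a : Compacts H) : star (star a) = a :=
  Subtype.ext (star_star a.1)

theorem norm_star_compacts (a : Compacts H) : ‖star a‖ = ‖a‖ := norm_star a.1

theorem norm_star_sub_star_compacts (a b : Compacts H) : ‖star a - star b‖ = ‖a - b‖ := by
  change ‖star a.1 - star b.1‖ = ‖a.1 - b.1‖
  rw [← star_sub, norm_star]

end Compact

/-! ## Ample modules -/

section Modules

variable {X : Type*} [MetricSpace X]
variable {H : Type*} [NormedAddCommGroup H] [InnerProductSpace ℂ H] [CompleteSpace H]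

/-- `ρ` turns the infinite-dimensional separable Hilbert space `H` into an ample `X`-module. -/
structure IsAmpleModule (ρ : C₀(X, ℂ) →⋆ₙₐ[ℂ] (H →L[ℂ] H)) : Prop where
  infiniteDimensional : ¬ FiniteDimensional ℂ H
  separable : TopologicalSpace.SeparableSpace H
  nondegenerate :
    (Submodule.span ℂ {η : H | ∃ (f : C₀(X, ℂ)) (ξ : H), η = ρ f ξ}).topologicalClosure = ⊤
  ample : ∀ f : C₀(X, ℂ), f ≠ 0 → ¬ IsCompactOperator (ρ f)

/-- `T` is locally compact. -/
def IsLocallyCompactOp (ρ : C₀(X, ℂ) →⋆ₙₐ[ℂ] (H →L[ℂ] H)) (T : H →L[ℂ] H) : Prop :=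
  ∀ f : C₀(X, ℂ), IsCompactOperator (ρ f * T : H →L[ℂ] H) ∧
    IsCompactOperator (T * ρ f : H →L[ℂ] H)

/-- The closed linear span of all `ρ(f)ξ`, where `f` vanishes off the set `U`. For open `U` this
is the range of the projection `χ_U`, the strong limit of `ρ(f)` as `0 ≤ f ≤ 1` increases to the
indicator function of `U`. -/
def openSubspace (ρ : C₀(X, ℂ) →⋆ₙₐ[ℂ] (H →L[ℂ] H)) (U : Set X) : ClosedSubmodule ℂ H :=
  (Submodule.span ℂ {η : H | ∃ (f : C₀(X, ℂ)) (ξ : H), (∀ x ∉ U, f x = 0) ∧ η = ρ f ξ}).closure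

/-- The projection `χ_E`, for `E` a Borel set, given by the extension of `ρ` to the bounded Borel
functions, that is, by the spectral measure of `ρ`. The measures `E ↦ ⟪ξ, χ_E ξ⟫` are finite Borel
measures on a metric space, hence outer regular, so that `χ_E` is the infimum of the
projections `χ_U` over the open sets `U` that contain `E`. -/
def chi (ρ : C₀(X, ℂ) →⋆ₙₐ[ℂ] (H →L[ℂ] H)) (E : Set X) : H →L[ℂ] H :=
  (⨅ U : {U : Set X // IsOpen U ∧ E ⊆ U}, openSubspace ρ U.1).toSubmodule.starProjection

theorem star_chi (ρ : C₀(X, ℂ) →⋆ₙₐ[ℂ] (H →L[ℂ] H)) (E : Set X) : star (chi ρ E) = chi ρ E :=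
  isSelfAdjoint_starProjection _

end Modules

/-! ## Operator-valued maps and the operators `Λ(g)` -/

section Lambda

variable {X : Type*} [MetricSpace X]
variable {H : Type*} [NormedAddCommGroup H] [InnerProductSpace ℂ H] [CompleteSpace H]
variable {K : Type*} [NormedAddCommGroup K] [InnerProductSpace ℂ K] [CompleteSpace K]

/-- `E` is a countable Borel partition of `X`, and `g` is constant with value `a n` on `E n`. -/
structure IsPartitionFor (g : X → Compacts K) (E : ℕ → Set X) (a : ℕ → Compacts K) : Prop where
  measurable : ∀ n, @MeasurableSet X (borel X) (E n)
  disjoint : ∀ m n, m ≠ n → Disjoint (E m) (E n)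
  cover : ⋃ n, E n = univ
  value : ∀ n, ∀ x ∈ E n, g x = a n

/-- `g` is countably-valued. -/
def IsCountablyValued (g : X → Compacts K) : Prop :=
  ∃ E a, IsPartitionFor g E a

/-- `g` is strongly measurable: a pointwise limit of countably-valued maps. -/
def IsStronglyMeasurable (g : X → Compacts K) : Prop :=
  ∃ u : ℕ → X → Compacts K, (∀ k, IsCountablyValued (u k)) ∧
    ∀ x, Tendsto (fun k => u k x) atTop (𝓝 (g x))

/-- `g` has `(δ, R)`-variation. -/
def HasVariation (g : X → Compacts K) (δ R : ℝ) : Prop :=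
  ∀ x y : X, dist x y < R → ‖g x - g y‖ < δ

/-- `g` is countably-valued and `L = Λ(g)`: for a countable Borel partition `E` on which `g` takes
the values `a n`, the operator `L` is block-diagonal with respect to the decomposition of `H ⊗ K`
into the ranges of `χ_{E n} ⊗ 1`, and equals `1 ⊗ a n` on the `n`-th block. -/
def IsLambdaCountable (ρ : C₀(X, ℂ) →⋆ₙₐ[ℂ] (H →L[ℂ] H)) (g : X → Compacts K)
    (L : HilbertTensor H K →L[ℂ] HilbertTensor H K) : Prop :=
  ∃ E a, IsPartitionFor g E a ∧
    ∀ n, L * tensorOp (chi ρ (E n)) 1 = tensorOp (chi ρ (E n)) (a n : K →L[ℂ] K) ∧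
      tensorOp (chi ρ (E n)) 1 * L = tensorOp (chi ρ (E n)) (a n : K →L[ℂ] K)

/-- `L` is the norm limit of `Λ(u k)` for a sequence of countably-valued maps `u k` that converges
to `g` uniformly. -/
def IsLambda (ρ : C₀(X, ℂ) →⋆ₙₐ[ℂ] (H →L[ℂ] H)) (g : X → Compacts K)
    (L : HilbertTensor H K →L[ℂ] HilbertTensor H K) : Prop :=
  ∃ (u : ℕ → X → Compacts K) (M : ℕ → HilbertTensor H K →L[ℂ] HilbertTensor H K),
    (∀ k, IsLambdaCountable ρ (u k) (M k)) ∧ TendstoUniformly u g atTop ∧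
      Tendsto M atTop (𝓝 L)

open Classical in
/-- The operator `Λ(g)`. For a non-degenerate `ρ` and a bounded strongly measurable `g` there is
exactly one `L` with `IsLambda ρ g L`; the value `0` is only a default for other data. -/
def Lambda (ρ : C₀(X, ℂ) →⋆ₙₐ[ℂ] (H →L[ℂ] H)) (g : X → Compacts K) :
    HilbertTensor H K →L[ℂ] HilbertTensor H K :=
  if h : ∃! L, IsLambda ρ g L then h.choose else 0

theorem Lambda_eq {ρ : C₀(X, ℂ) →⋆ₙₐ[ℂ] (H →L[ℂ] H)} {g : X → Compacts K}
    (h : ∃! L, IsLambda ρ g L) {L : HilbertTensor H K →L[ℂ] HilbertTensor H K}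
    (hL : IsLambda ρ g L) : Lambda ρ g = L := by
  rw [Lambda, dif_pos h]
  exact h.unique h.choose_spec.1 hL

theorem IsPartitionFor.star {g : X → Compacts K} {E : ℕ → Set X} {a : ℕ → Compacts K}
    (h : IsPartitionFor g E a) :
    IsPartitionFor (fun x => star (g x)) E (fun n => star (a n)) :=
  ⟨h.measurable, h.disjoint, h.cover, fun n x hx => congrArg Star.star (h.value n x hx)⟩

theorem continuous_star_compacts : Continuous (fun a : Compacts K => star a) :=
  Continuous.subtype_mk (continuous_star.comp continuous_subtype_val) _

theorem IsStronglyMeasurable.star {g : X → Compacts K} (h : IsStronglyMeasurable g) :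
    IsStronglyMeasurable (fun x => star (g x)) := by
  obtain ⟨u, hu, hlim⟩ := h
  refine ⟨fun k x => Star.star (u k x), fun k => ?_, fun x => ?_⟩
  · obtain ⟨E, a, hE⟩ := hu k
    exact ⟨E, _, hE.star⟩
  · exact (continuous_star_compacts.tendsto _).comp (hlim x)

theorem HasVariation.star {g : X → Compacts K} {δ R : ℝ} (h : HasVariation g δ R) :
    HasVariation (fun x => star (g x)) δ R := fun x y hxy => by
  rw [norm_star_sub_star_compacts]
  exact h x y hxy

theorem IsLambda.star {ρ : C₀(X, ℂ) →⋆ₙₐ[ℂ] (H →L[ℂ] H)} {g : X → Compacts K}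
    {L : HilbertTensor H K →L[ℂ] HilbertTensor H K} (h : IsLambda ρ g L) :
    IsLambda ρ (fun x => star (g x)) (star L) := by
  obtain ⟨u, M, hM, hu, hL⟩ := h
  refine ⟨fun k x => Star.star (u k x), fun k => Star.star (M k), fun k => ?_, ?_, ?_⟩
  · obtain ⟨E, a, hE, hb⟩ := hM k
    refine ⟨E, _, hE.star, fun n => ?_⟩
    have h1 : tensorOp (chi ρ (E n)) (1 : K →L[ℂ] K) =
        Star.star (tensorOp (chi ρ (E n)) (1 : K →L[ℂ] K)) := by
      rw [← tensorOp_star, star_chi, star_one]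
    have h2 : tensorOp (chi ρ (E n)) ((Star.star (a n) : Compacts K) : K →L[ℂ] K) =
        Star.star (tensorOp (chi ρ (E n)) (a n : K →L[ℂ] K)) := by
      rw [← tensorOp_star, star_chi, coe_star_compacts]
    rw [h1, h2, ← star_mul, ← star_mul, (hb n).1, (hb n).2]
    exact ⟨rfl, rfl⟩
  · rw [Metric.tendstoUniformly_iff] at hu ⊢
    intro ε hε
    filter_upwards [hu ε hε] with k hk x
    rw [dist_eq_norm, norm_star_sub_star_compacts, ← dist_eq_norm]
    exact hk x
  · exact (continuous_star.tendsto _).comp hL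

theorem isLambda_star_iff {ρ : C₀(X, ℂ) →⋆ₙₐ[ℂ] (H →L[ℂ] H)} {g : X → Compacts K}
    {L : HilbertTensor H K →L[ℂ] HilbertTensor H K} :
    IsLambda ρ (fun x => star (g x)) L ↔ IsLambda ρ g (star L) := by
  constructor
  · intro h
    have h' := h.star
    simpa only [star_star_compacts] using h'
  · intro h
    have h' := h.star
    rwa [star_star] at h'

theorem Lambda_star (ρ : C₀(X, ℂ) →⋆ₙₐ[ℂ] (H →L[ℂ] H)) (g : X → Compacts K) :
    Lambda ρ (fun x => star (g x)) = star (Lambda ρ g) := by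
  by_cases h : ∃! L, IsLambda ρ g L
  · obtain ⟨L, hL, hu⟩ := h
    rw [Lambda_eq ⟨L, hL, hu⟩ hL]
    refine Lambda_eq ⟨star L, hL.star, fun L' hL' => ?_⟩ hL.star
    rw [← hu _ (isLambda_star_iff.mp hL'), star_star]
  · have h' : ¬ ∃! L, IsLambda ρ (fun x => star (g x)) L := by
      rintro ⟨L, hL, hu⟩
      refine h ⟨star L, isLambda_star_iff.mp hL, fun L' hL' => ?_⟩
      rw [← hu _ hL'.star, star_star]
    rw [Lambda, Lambda, dif_neg h, dif_neg h', star_zero]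

end Lambda

/-! ## The strongly quasi-local algebra -/

section Algebra

variable {X : Type*} [MetricSpace X]
variable {H : Type*} [NormedAddCommGroup H] [InnerProductSpace ℂ H] [CompleteSpace H]
variable (K : Type*) [NormedAddCommGroup K] [InnerProductSpace ℂ K] [CompleteSpace K]

/-- `T` is strongly quasi-local, with `K` the auxiliary Hilbert space. -/
def IsStronglyQuasiLocal (ρ : C₀(X, ℂ) →⋆ₙₐ[ℂ] (H →L[ℂ] H)) (T : H →L[ℂ] H) : Prop :=
  ∀ ε : ℝ, 0 < ε → ∃ δ : ℝ, 0 < δ ∧ ∃ R : ℝ, 0 < R ∧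
    ∀ g : X → Compacts K, IsStronglyMeasurable g → (∀ x, ‖g x‖ ≤ 1) → HasVariation g δ R →
      ‖tensorOp T (1 : K →L[ℂ] K) * Lambda ρ g - Lambda ρ g * tensorOp T (1 : K →L[ℂ] K)‖ < ε

variable {K}

theorem HasVariation.mono {g : X → Compacts K} {δ δ' R R' : ℝ} (h : HasVariation g δ R)
    (hδ : δ ≤ δ') (hR : R' ≤ R) : HasVariation g δ' R' :=
  fun x y hxy => (h x y (hxy.trans_le hR)).trans_le hδ

variable {ρ : C₀(X, ℂ) →⋆ₙₐ[ℂ] (H →L[ℂ] H)} {S T : H →L[ℂ] H}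

/-- A bound for the commutators of `T'` by those of `S` and `T` with the same `g`. -/
theorem IsStronglyQuasiLocal.of_bound {T' : H →L[ℂ] H} (C : ℝ)
    (hS : IsStronglyQuasiLocal K ρ S) (hT : IsStronglyQuasiLocal K ρ T)
    (h : ∀ g : X → Compacts K,
      ‖tensorOp T' (1 : K →L[ℂ] K) * Lambda ρ g - Lambda ρ g * tensorOp T' (1 : K →L[ℂ] K)‖ ≤
      C * (‖tensorOp S (1 : K →L[ℂ] K) * Lambda ρ g - Lambda ρ g * tensorOp S (1 : K →L[ℂ] K)‖ +
        ‖tensorOp T (1 : K →L[ℂ] K) * Lambda ρ g - Lambda ρ g * tensorOp T (1 : K →L[ℂ] K)‖)) :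
    IsStronglyQuasiLocal K ρ T' := by
  intro ε hε
  have hC : 0 < 2 * (|C| + 1) := by positivity
  obtain ⟨δ₁, hδ₁, R₁, hR₁, h₁⟩ := hS (ε / (2 * (|C| + 1))) (by positivity)
  obtain ⟨δ₂, hδ₂, R₂, hR₂, h₂⟩ := hT (ε / (2 * (|C| + 1))) (by positivity)
  refine ⟨min δ₁ δ₂, lt_min hδ₁ hδ₂, max R₁ R₂, lt_max_of_lt_left hR₁, fun g hg hg1 hv => ?_⟩
  have a₁ := h₁ g hg hg1 (hv.mono (min_le_left _ _) (le_max_left _ _))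
  have a₂ := h₂ g hg hg1 (hv.mono (min_le_right _ _) (le_max_right _ _))
  refine (h g).trans_lt ?_
  set p := ‖tensorOp S (1 : K →L[ℂ] K) * Lambda ρ g - Lambda ρ g * tensorOp S (1 : K →L[ℂ] K)‖
  set q := ‖tensorOp T (1 : K →L[ℂ] K) * Lambda ρ g - Lambda ρ g * tensorOp T (1 : K →L[ℂ] K)‖
  have hp : 0 ≤ p := norm_nonneg _
  have hq : 0 ≤ q := norm_nonneg _
  rw [lt_div_iff₀ hC] at a₁ a₂
  nlinarith [le_abs_self C, abs_nonneg C]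

theorem IsStronglyQuasiLocal.add (hS : IsStronglyQuasiLocal K ρ S)
    (hT : IsStronglyQuasiLocal K ρ T) : IsStronglyQuasiLocal K ρ (S + T) := by
  refine hS.of_bound 1 hT fun g => ?_
  rw [tensorOp_add, one_mul]
  refine le_trans (le_of_eq ?_) (norm_add_le _ _)
  congr 1
  noncomm_ring

theorem IsStronglyQuasiLocal.smul (c : ℂ) (hT : IsStronglyQuasiLocal K ρ T) :
    IsStronglyQuasiLocal K ρ (c • T) := by
  refine hT.of_bound ‖c‖ hT fun g => ?_
  rw [tensorOp_smul, smul_mul_assoc, mul_smul_comm, ← smul_sub, norm_smul]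
  gcongr
  exact le_add_of_nonneg_right (norm_nonneg _)

theorem isStronglyQuasiLocal_zero : IsStronglyQuasiLocal K ρ 0 := by
  intro ε hε
  refine ⟨1, one_pos, 1, one_pos, fun g _ _ _ => ?_⟩
  have h : tensorOp (0 : H →L[ℂ] H) (1 : K →L[ℂ] K) = 0 := by
    have := tensorOp_smul (0 : ℂ) (0 : H →L[ℂ] H) (1 : K →L[ℂ] K)
    simpa using this
  simpa [h] using hε

theorem IsStronglyQuasiLocal.mul (hS : IsStronglyQuasiLocal K ρ S)
    (hT : IsStronglyQuasiLocal K ρ T) : IsStronglyQuasiLocal K ρ (S * T) := by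
  refine hS.of_bound (‖tensorOp S (1 : K →L[ℂ] K)‖ + ‖tensorOp T (1 : K →L[ℂ] K)‖) hT fun g => ?_
  have h1 : tensorOp (S * T) (1 : K →L[ℂ] K) =
      tensorOp S (1 : K →L[ℂ] K) * tensorOp T (1 : K →L[ℂ] K) := by
    rw [← tensorOp_mul, one_mul]
  rw [h1]
  generalize tensorOp S (1 : K →L[ℂ] K) = A
  generalize tensorOp T (1 : K →L[ℂ] K) = B
  generalize Lambda ρ g = L
  have h2 : A * B * L - L * (A * B) = A * (B * L - L * B) + (A * L - L * A) * B := by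
    noncomm_ring
  rw [h2]
  have h3 := norm_add_le (A * (B * L - L * B)) ((A * L - L * A) * B)
  have h4 := norm_mul_le A (B * L - L * B)
  have h5 := norm_mul_le (A * L - L * A) B
  nlinarith [mul_nonneg (norm_nonneg A) (norm_nonneg (A * L - L * A)),
    mul_nonneg (norm_nonneg B) (norm_nonneg (B * L - L * B))]

theorem IsStronglyQuasiLocal.star (hT : IsStronglyQuasiLocal K ρ T) :
    IsStronglyQuasiLocal K ρ (star T) := by
  intro ε hε
  obtain ⟨δ, hδ, R, hR, h⟩ := hT ε hε
  refine ⟨δ, hδ, R, hR, fun g hg hg1 hv => ?_⟩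
  have key := h (fun x => Star.star (g x)) hg.star
    (fun x => (norm_star_compacts (g x)).le.trans (hg1 x)) hv.star
  rw [Lambda_star, ← norm_star, star_sub, star_mul, star_mul, star_star, ← tensorOp_star,
    star_one, norm_sub_rev] at key
  exact key

variable (K) in
/-- The strongly quasi-local algebra of the module given by `ρ`: the star-algebra of all locally
compact and strongly quasi-local operators. -/
def strongQuasiLocalAlgebra (ρ : C₀(X, ℂ) →⋆ₙₐ[ℂ] (H →L[ℂ] H)) :
    NonUnitalStarSubalgebra ℂ (H →L[ℂ] H) where
  carrier := {T | IsLocallyCompactOp ρ T ∧ IsStronglyQuasiLocal K ρ T}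
  add_mem' := by
    rintro S T ⟨hS, hS'⟩ ⟨hT, hT'⟩
    refine ⟨fun f => ?_, hS'.add hT'⟩
    rw [mul_add, add_mul]
    exact ⟨(hS f).1.add (hT f).1, (hS f).2.add (hT f).2⟩
  zero_mem' := by
    refine ⟨fun f => ?_, isStronglyQuasiLocal_zero⟩
    rw [mul_zero, zero_mul]
    exact ⟨isCompactOperator_zero, isCompactOperator_zero⟩
  mul_mem' := by
    rintro S T ⟨hS, hS'⟩ ⟨hT, hT'⟩
    refine ⟨fun f => ?_, hS'.mul hT'⟩
    rw [← mul_assoc, mul_assoc S T]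
    exact ⟨(hS f).1.comp_clm T, (hT f).2.clm_comp S⟩
  smul_mem' := by
    rintro c T ⟨hT, hT'⟩
    refine ⟨fun f => ?_, hT'.smul c⟩
    rw [mul_smul_comm, smul_mul_assoc]
    exact ⟨(hT f).1.smul c, (hT f).2.smul c⟩
  star_mem' := by
    rintro T ⟨hT, hT'⟩
    refine ⟨fun f => ?_, hT'.star⟩
    have h1 : ρ f * star T = star (T * ρ (star f)) := by
      rw [star_mul, map_star, star_star]
    have h2 : star T * ρ f = star (ρ (star f) * T) := by
      rw [star_mul, map_star, star_star]
    rw [h1, h2]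
    exact ⟨isCompactOperator_star (hT (star f)).2, isCompactOperator_star (hT (star f)).1⟩

end Algebra

end StrongQuasiLocal

end

/-! A coarse equivalence `f : X → Y` lets both spaces be cut into Borel pieces over one index set.
Choose a maximal separated set in `X` whose separation is so large that its image in `Y` is still
separated; both sets are nets. Assigning every point to a nearby net point gives uniformly bounded
partitions `A i` of `X` and `B i` of `Y`, each piece containing a ball of radius 1/2
(`CoarselyEquivalent.exists_partitions`). By ampleness all the projections `chi ρ (A i)` and `chi ρ'
(B i)` have infinite rank. Separability then gives a unitary `U` that matches them piece by piece
(`IsResolution.exists_unitary`), and conjugation by `U` is the isomorphism.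

Conjugation preserves local compactness because that property can be tested on the pieces of a
bounded partition (`isLocallyCompactOp_of_chi`). For strong quasi-locality, take `g` on `Y` of small
variation and replace it by the step map with value `g (q i)` on `B i`. This moves `Λ(g)` by no more
than the variation (`IsLambda.norm_sub_le`). The unitary `U ⊗ 1` carries `Λ` of the step map with
the same values on the `A i` to `Λ` of the one on the `B i` (`exists_isLambda_step`), and the step
map on `X` has small variation because distances between the base points control each other. So the
commutator bound passes from `T` to its conjugate.

The analytic input is that the `chi ρ E`, defined as infima over open neighbourhoods, behave like a
spectral measure. This rests on the identity `μ_ξ(E) = ‖χ_E ξ‖²` for the Riesz measure `μ_ξ` of `f ↦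
⟪ξ, ρ(f)ξ⟫` (`vectorMeasure_eq`), which turns orthogonality and completeness of the projections into
statements about null sets. -/

noncomputable section

namespace StrongQuasiLocal

/-! ### Orthogonal resolutions of a Hilbert space and block-diagonal operators -/

section Resolution

variable {H : Type*} [NormedAddCommGroup H] [InnerProductSpace ℂ H] [CompleteSpace H]
variable {ι : Type*}

/-- A family of pairwise orthogonal projections whose ranges span a dense subspace. -/
structure IsResolution (P : ι → H →L[ℂ] H) : Prop where
  star_eq : ∀ i, star (P i) = P i
  mul_self : ∀ i, P i * P i = P i
  mul_eq_zero : ∀ i j, i ≠ j → P i * P j = 0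
  eq_zero : ∀ ξ, (∀ i, P i ξ = 0) → ξ = 0

namespace IsResolution

variable {P : ι → H →L[ℂ] H}

theorem apply_apply (hP : IsResolution P) (i : ι) (ξ : H) : P i (P i ξ) = P i ξ :=
  congrArg (fun A : H →L[ℂ] H => A ξ) (hP.mul_self i)

theorem apply_apply_of_ne (hP : IsResolution P) {i j : ι} (h : i ≠ j) (ξ : H) :
    P i (P j ξ) = 0 :=
  congrArg (fun A : H →L[ℂ] H => A ξ) (hP.mul_eq_zero i j h)

theorem inner_left (hP : IsResolution P) (i : ι) (ξ η : H) :
    inner ℂ (P i ξ) η = inner ℂ ξ (P i η) := by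
  conv_rhs => rw [← hP.star_eq i, ContinuousLinearMap.star_eq_adjoint,
    ContinuousLinearMap.adjoint_inner_right]

theorem orthogonalFamily (hP : IsResolution P) :
    OrthogonalFamily ℂ (fun i => LinearMap.range (P i : H →ₗ[ℂ] H))
      fun i => (LinearMap.range (P i : H →ₗ[ℂ] H)).subtypeₗᵢ := by
  rintro i j hij ⟨_, v, rfl⟩ ⟨_, w, rfl⟩
  change inner ℂ (P i v) (P j w) = 0
  rw [hP.inner_left, hP.apply_apply_of_ne hij, inner_zero_right]

theorem norm_sum_sq (hP : IsResolution P) (s : Finset ι) (v : ι → H) :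
    ‖∑ i ∈ s, P i (v i)‖ ^ 2 = ∑ i ∈ s, ‖P i (v i)‖ ^ 2 :=
  hP.orthogonalFamily.norm_sum (fun i => ⟨P i (v i), v i, rfl⟩) s

theorem summable_iff (hP : IsResolution P) (v : ι → H) :
    (Summable fun i => P i (v i)) ↔ Summable fun i => ‖P i (v i)‖ ^ 2 :=
  hP.orthogonalFamily.summable_iff_norm_sq_summable (fun i => ⟨P i (v i), v i, rfl⟩)

/-- Bessel's inequality: the partial sum `η` satisfies `⟪η, ξ⟫ = ‖η‖²`, so Cauchy–Schwarz gives `‖η‖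
≤ ‖ξ‖`. -/
theorem sum_norm_sq_le (hP : IsResolution P) (s : Finset ι) (ξ : H) :
    ∑ i ∈ s, ‖P i ξ‖ ^ 2 ≤ ‖ξ‖ ^ 2 := by
  set η := ∑ i ∈ s, P i ξ with hη
  have h1 : ‖η‖ ^ 2 = ∑ i ∈ s, ‖P i ξ‖ ^ 2 := hP.norm_sum_sq s fun _ => ξ
  have h2 : inner ℂ η ξ = ((‖η‖ ^ 2 : ℝ) : ℂ) := by
    rw [h1, hη, sum_inner]
    push_cast
    refine Finset.sum_congr rfl fun i _ => ?_
    rw [← hP.apply_apply, hP.inner_left, inner_self_eq_norm_sq_to_K, hP.apply_apply]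
    rfl
  have h3 : ‖η‖ ^ 2 ≤ ‖η‖ * ‖ξ‖ := by
    have := norm_inner_le_norm (𝕜 := ℂ) η ξ
    rw [h2, Complex.norm_real, Real.norm_of_nonneg (by positivity)] at this
    exact this
  rw [← h1]
  have h4 : ‖η‖ ≤ ‖ξ‖ := by
    by_contra! h
    nlinarith [norm_nonneg ξ]
  gcongr

theorem summable_norm_sq (hP : IsResolution P) (ξ : H) : Summable fun i => ‖P i ξ‖ ^ 2 :=
  summable_of_sum_le (fun _ => by positivity) fun s => hP.sum_norm_sq_le s ξ

/-- Bessel's inequality makes the series converge; each `P j` kills the difference between its sum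
and `ξ`, so the difference is zero. -/
theorem hasSum (hP : IsResolution P) (ξ : H) : HasSum (fun i => P i ξ) ξ := by
  have hs : Summable fun i => P i ξ := (hP.summable_iff fun _ => ξ).mpr (hP.summable_norm_sq ξ)
  have hs' : (∑' i, P i ξ) = ξ := by
    rw [← sub_eq_zero]
    refine hP.eq_zero _ fun j => ?_
    rw [map_sub, (P j).map_tsum hs, tsum_eq_single j fun i hi => hP.apply_apply_of_ne hi.symm ξ,
      hP.apply_apply, sub_self]
  have h := hs.hasSum
  rwa [hs'] at h

theorem hasSum_norm_sq (hP : IsResolution P) (ξ : H) :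
    HasSum (fun i => ‖P i ξ‖ ^ 2) (‖ξ‖ ^ 2) := by
  have h := ((continuous_norm.pow 2).tendsto ξ).comp (hP.hasSum ξ)
  refine h.congr fun s => ?_
  exact hP.norm_sum_sq s fun _ => ξ

/-- A block-diagonal operator is bounded by the bound of its blocks. -/
theorem norm_le (hP : IsResolution P) {D : H →L[ℂ] H} {C : ℝ} (hC : 0 ≤ C)
    (hD : ∀ i, P i * D = D * P i) (hb : ∀ i, ‖D * P i‖ ≤ C) : ‖D‖ ≤ C := by
  refine D.opNorm_le_bound hC fun ξ => ?_
  refine (sq_le_sq₀ (norm_nonneg _) (by positivity)).mp ?_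
  rw [mul_pow]
  refine hasSum_le (fun i => ?_) (hP.hasSum_norm_sq (D ξ))
    ((hP.hasSum_norm_sq ξ).mul_left (C ^ 2))
  have h : P i (D ξ) = (D * P i) (P i ξ) := by
    rw [mul_apply_eq_comp, hP.apply_apply]
    exact congrArg (fun A : H →L[ℂ] H => A ξ) (hD i)
  rw [h, ← mul_pow]
  gcongr
  exact ((D * P i).le_opNorm _).trans (by gcongr; exact hb i)

/-- A uniformly bounded family of blocks defines a block-diagonal operator. -/
theorem exists_blockDiagonal [Countable ι] (hP : IsResolution P) {D : ι → H →L[ℂ] H} {C : ℝ}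
    (hl : ∀ i, P i * D i = D i) (hr : ∀ i, D i * P i = D i) (hb : ∀ i, ‖D i‖ ≤ C) :
    ∃ L : H →L[ℂ] H, ∀ i, L * P i = D i ∧ P i * L = D i := by
  have hl' : ∀ i ξ, P i (D i ξ) = D i ξ := fun i ξ =>
    congrArg (fun A : H →L[ℂ] H => A ξ) (hl i)
  have hr' : ∀ i ξ, D i (P i ξ) = D i ξ := fun i ξ =>
    congrArg (fun A : H →L[ℂ] H => A ξ) (hr i)
  have hs : ∀ ξ, Summable fun i => D i ξ := by
    intro ξ
    have h : Summable fun i => P i (D i ξ) := by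
      refine (hP.summable_iff fun i => D i ξ).mpr ?_
      refine Summable.of_nonneg_of_le (fun _ => by positivity) (fun i => ?_)
        ((hP.summable_norm_sq ξ).mul_left (C ^ 2))
      rw [hl', ← hr', ← mul_pow]
      gcongr
      exact ((D i).le_opNorm _).trans (by gcongr; exact hb i)
    simpa only [hl'] using h
  -- The partial sums converge strongly but in general not in norm; Banach–Steinhaus makes the
  -- pointwise limit a bounded operator.
  have hlim : Tendsto (fun (s : Finset ι) ξ => (∑ i ∈ s, D i) ξ) atTop
      (𝓝 fun ξ => ∑' i, D i ξ) := by
    refine tendsto_pi_nhds.mpr fun ξ => ?_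
    have h : Tendsto (fun s : Finset ι => ∑ i ∈ s, D i ξ) atTop (𝓝 (∑' i, D i ξ)) :=
      (hs ξ).hasSum
    simpa only [sum_apply] using h
  refine ⟨continuousLinearMapOfTendsto (fun s : Finset ι => ∑ i ∈ s, D i) hlim, fun i => ⟨?_, ?_⟩⟩
  · ext ξ
    change ∑' j, D j (P i ξ) = D i ξ
    rw [tsum_eq_single i fun j hj => ?_, hr']
    rw [← hr', hP.apply_apply_of_ne hj, map_zero]
  · ext ξ
    change P i (∑' j, D j ξ) = D i ξ
    rw [(P i).map_tsum (hs ξ), tsum_eq_single i fun j hj => ?_, hl']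
    rw [← hl', hP.apply_apply_of_ne hj.symm]

end IsResolution

/-- Distinct vectors of an orthonormal basis are at distance `√2`, so balls of radius 1/2 around
them are disjoint and separability makes the basis countable. It is infinite, as a finite one would
force finite dimension. -/
theorem exists_hilbertBasis_nat {E : Type*} [NormedAddCommGroup E] [InnerProductSpace ℂ E]
    [CompleteSpace E] [TopologicalSpace.SeparableSpace E] (hE : ¬ FiniteDimensional ℂ E) :
    Nonempty (HilbertBasis ℕ ℂ E) := by
  obtain ⟨w, b, hb⟩ := exists_hilbertBasis ℂ E
  have hc : Countable w := by
    have ho := b.orthonormal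
    refine (Set.PairwiseDisjoint.countable_of_isOpen (s := fun i : w => Metric.ball (b i) (1 / 2))
      (a := Set.univ) ?_ (fun i _ => Metric.isOpen_ball)
      fun i _ => ⟨b i, Metric.mem_ball_self (by norm_num)⟩) |> Set.countable_univ_iff.mp
    intro i _ j _ hij
    refine Metric.ball_disjoint_ball ?_
    have h1 : ‖b i - b j‖ ^ 2 = 2 := by
      rw [@norm_sub_sq ℂ, ho.1, ho.1, ho.2 hij]
      norm_num
    rw [dist_eq_norm]
    nlinarith [norm_nonneg (b i - b j)]
  have hi : Infinite w := by
    by_contra h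
    rw [not_infinite_iff_finite] at h
    have := Fintype.ofFinite w
    exact hE b.toOrthonormalBasis.toBasis.finiteDimensional_of_finite
  have := Encodable.ofCountable w
  have := Denumerable.ofEncodableOfInfinite w
  let e := Denumerable.eqv w
  refine ⟨HilbertBasis.mk (v := b ∘ e.symm) (b.orthonormal.comp _ e.symm.injective) ?_⟩
  rw [e.symm.surjective.range_comp, b.dense_span]

/-- Bases of the ranges are glued together. A vector orthogonal to all of them has zero component in
every range, hence vanishes. -/
theorem IsResolution.exists_hilbertBasis [TopologicalSpace.SeparableSpace H]
    {P : ι → H →L[ℂ] H} (hP : IsResolution P)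
    (hd : ∀ i, ¬ FiniteDimensional ℂ (LinearMap.range (P i : H →ₗ[ℂ] H))) :
    ∃ b : HilbertBasis (ι × ℕ) ℂ H, (∀ i n, P i (b (i, n)) = b (i, n)) := by
  have hcl : ∀ i, IsClosed (LinearMap.range (P i : H →ₗ[ℂ] H) : Set H) := by
    intro i
    have : (LinearMap.range (P i : H →ₗ[ℂ] H) : Set H) = {ξ | P i ξ = ξ} := by
      ext ξ
      constructor
      · rintro ⟨η, rfl⟩
        exact hP.apply_apply i η
      · exact fun h => ⟨ξ, h⟩
    rw [this]
    exact isClosed_eq (P i).continuous continuous_id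
  have hcs : ∀ i, CompleteSpace (LinearMap.range (P i : H →ₗ[ℂ] H)) := fun i =>
    (hcl i).completeSpace_coe
  have b := fun i => (exists_hilbertBasis_nat (hd i)).some
  have hfix : ∀ i n, P i (b i n : H) = b i n := by
    intro i n
    obtain ⟨η, hη⟩ := (b i n).2
    rw [← hη]
    exact hP.apply_apply i η
  have ho : Orthonormal ℂ fun p : ι × ℕ => (b p.1 p.2 : H) := by
    constructor
    · rintro ⟨i, n⟩
      exact (b i).orthonormal.1 n
    · rintro ⟨i, n⟩ ⟨j, m⟩ h
      by_cases hij : i = j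
      · subst hij
        exact (b i).orthonormal.2 fun hnm => h (Prod.ext rfl hnm)
      · exact hP.orthogonalFamily hij (b i n) (b j m)
  have hsp : (Submodule.span ℂ (Set.range fun p : ι × ℕ => (b p.1 p.2 : H)))ᗮ = ⊥ := by
    rw [Submodule.eq_bot_iff]
    intro ξ hξ
    refine hP.eq_zero ξ fun i => ?_
    have h1 : (⟨P i ξ, ξ, rfl⟩ : LinearMap.range (P i : H →ₗ[ℂ] H)) = 0 := by
      refine (b i).repr.injective ?_
      ext n
      rw [(b i).repr_apply_apply, map_zero]
      change inner ℂ (b i n : H) (P i ξ) = 0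
      rw [← hP.inner_left, hfix]
      exact hξ _ (Submodule.subset_span ⟨(i, n), rfl⟩)
    exact congrArg Subtype.val h1
  refine ⟨HilbertBasis.mkOfOrthogonalEqBot ho hsp, fun i n => ?_⟩
  rw [HilbertBasis.coe_mkOfOrthogonalEqBot]
  exact hfix i n

/-- Two resolutions with infinite-dimensional blocks are unitarily equivalent. -/
theorem IsResolution.exists_unitary {H' : Type*} [NormedAddCommGroup H'] [InnerProductSpace ℂ H']
    [CompleteSpace H'] [TopologicalSpace.SeparableSpace H] [TopologicalSpace.SeparableSpace H']
    {P : ι → H →L[ℂ] H} {Q : ι → H' →L[ℂ] H'} (hP : IsResolution P) (hQ : IsResolution Q)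
    (hdP : ∀ i, ¬ FiniteDimensional ℂ (LinearMap.range (P i : H →ₗ[ℂ] H)))
    (hdQ : ∀ i, ¬ FiniteDimensional ℂ (LinearMap.range (Q i : H' →ₗ[ℂ] H'))) :
    ∃ U : H ≃ₗᵢ[ℂ] H', ∀ i ξ, U (P i ξ) = Q i (U ξ) := by
  classical
  obtain ⟨b, hb⟩ := hP.exists_hilbertBasis hdP
  obtain ⟨c, hc⟩ := hQ.exists_hilbertBasis hdQ
  let U := b.repr.trans c.repr.symm
  have hU : ∀ p, U (b p) = c p := by
    intro p
    change c.repr.symm (b.repr (b p)) = c p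
    rw [b.repr_self, c.repr_symm_single]
  refine ⟨U, fun i ξ => ?_⟩
  -- Both sides are continuous and linear, so agreement on the adapted basis `b` is enough.
  have key : ((U : H →L[ℂ] H').comp (P i)) = (Q i).comp (U : H →L[ℂ] H') := by
    refine ContinuousLinearMap.ext_on (s := Set.range b) ?_ ?_
    · rw [dense_iff_closure_eq, ← Submodule.topologicalClosure_coe, b.dense_span]
      rfl
    · rintro _ ⟨⟨j, n⟩, rfl⟩
      change U (P i (b (j, n))) = Q i (U (b (j, n)))
      rw [hU, ← hb, ← hc]
      by_cases hij : i = j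
      · subst hij
        rw [hP.apply_apply, hQ.apply_apply, hb, hU, hc]
      · rw [hP.apply_apply_of_ne hij, hQ.apply_apply_of_ne hij, map_zero]
  exact congrArg (fun A : H →L[ℂ] H' => A ξ) key

end Resolution

/-! ### Strong limits of decreasing projections -/

section Projections

variable {H : Type*} [NormedAddCommGroup H] [InnerProductSpace ℂ H] [CompleteSpace H]

/-- The projections onto a directed family of closed subspaces converge strongly to the
projection onto the intersection. -/
theorem tendsto_starProjection_iInf {ι : Type*} [Preorder ι] {S : ι → ClosedSubmodule ℂ H}
    (hS : Antitone S) (ξ : H) :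
    Tendsto (fun i => (S i).toSubmodule.starProjection ξ) atTop
      (𝓝 ((⨅ i, S i).toSubmodule.starProjection ξ)) := by
  -- Orthogonal complements turn the decreasing family into an increasing one, whose projections
  -- converge to that of the closed supremum.
  have hm : Monotone fun i => (S i).toSubmoduleᗮ := fun i j hij =>
    Submodule.orthogonal_le (ClosedSubmodule.toSubmodule_le_toSubmodule.mpr (hS hij))
  have hc : CompleteSpace (⨆ i, (S i).toSubmoduleᗮ).topologicalClosure :=
    (Submodule.isClosed_topologicalClosure _).completeSpace_coe
  have h1 := Submodule.starProjection_tendsto_closure_iSup _ hm ξ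
  have h2 : (⨆ i, (S i).toSubmoduleᗮ).topologicalClosureᗮ = (⨅ i, S i).toSubmodule := by
    rw [Submodule.orthogonal_closure, ← Submodule.iInf_orthogonal,
      ClosedSubmodule.toSubmodule_iInf]
    refine iInf_congr fun i => ?_
    exact Submodule.orthogonal_orthogonal _
  have h3 := h1.const_sub ξ
  have h4 : ∀ W : Submodule ℂ H, ∀ [W.HasOrthogonalProjection],
      ξ - W.starProjection ξ = Wᗮ.starProjection ξ := fun W _ =>
    (Submodule.starProjection_orthogonal_val ξ).symm
  have h5 : ξ - (⨆ i, (S i).toSubmoduleᗮ).topologicalClosure.starProjection ξ =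
      (⨅ i, S i).toSubmodule.starProjection ξ := by
    rw [h4]
    congr 2
  rw [h5] at h3
  refine h3.congr fun i => ?_
  rw [h4]
  congr 2
  exact Submodule.orthogonal_orthogonal _

end Projections

/-! ### The scalar spectral measures of a representation -/

section Spectral

open MeasureTheory
open scoped CompactlySupported

variable {X : Type*} [MetricSpace X]
variable {H : Type*} [NormedAddCommGroup H] [InnerProductSpace ℂ H] [CompleteSpace H]

/-- A real-valued compactly supported function as a complex-valued one that vanishes at
infinity. -/
def ofRealC0 (f : C_c(X, ℝ)) : C₀(X, ℂ) where
  toFun x := (f x : ℂ)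
  continuous_toFun := Complex.continuous_ofReal.comp f.continuous
  zero_at_infty' := by
    have h := zero_at_infty (F := C_c(X, ℝ)) f
    have h2 := (Complex.continuous_ofReal.tendsto 0).comp h
    rwa [Complex.ofReal_zero] at h2

theorem ofRealC0_apply (f : C_c(X, ℝ)) (x : X) : ofRealC0 f x = (f x : ℂ) := rfl

theorem ofRealC0_mul (f g : C_c(X, ℝ)) : ofRealC0 (f * g) = ofRealC0 f * ofRealC0 g := by
  ext x
  simp [ofRealC0_apply]

theorem star_ofRealC0 (f : C_c(X, ℝ)) : star (ofRealC0 f) = ofRealC0 f := by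
  ext x
  simp [ofRealC0_apply]

theorem star_map_ofRealC0 (ρ : C₀(X, ℂ) →⋆ₙₐ[ℂ] (H →L[ℂ] H)) (f : C_c(X, ℝ)) :
    star (ρ (ofRealC0 f)) = ρ (ofRealC0 f) := by
  rw [← map_star, star_ofRealC0]

theorem inner_map_ofRealC0_left (ρ : C₀(X, ℂ) →⋆ₙₐ[ℂ] (H →L[ℂ] H)) (f : C_c(X, ℝ)) (ξ η : H) :
    inner ℂ (ρ (ofRealC0 f) ξ) η = inner ℂ ξ (ρ (ofRealC0 f) η) := by
  conv_rhs => rw [← star_map_ofRealC0, ContinuousLinearMap.star_eq_adjoint,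
    ContinuousLinearMap.adjoint_inner_right]

theorem inner_map_mul_self (ρ : C₀(X, ℂ) →⋆ₙₐ[ℂ] (H →L[ℂ] H)) (f : C_c(X, ℝ)) (ξ : H) :
    (inner ℂ ξ (ρ (ofRealC0 (f * f)) ξ)).re = ‖ρ (ofRealC0 f) ξ‖ ^ 2 := by
  rw [ofRealC0_mul, map_mul, mul_apply_eq_comp, ← inner_map_ofRealC0_left]
  exact inner_self_eq_norm_sq (𝕜 := ℂ) _

/-- The positive functional `f ↦ ⟪ξ, ρ(f)ξ⟫`. -/
def vectorState (ρ : C₀(X, ℂ) →⋆ₙₐ[ℂ] (H →L[ℂ] H)) (ξ : H) : C_c(X, ℝ) →ₚ[ℝ] ℝ :=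
  PositiveLinearMap.mk₀
    { toFun f := (inner ℂ ξ (ρ (ofRealC0 f) ξ)).re
      map_add' f g := by
        have h : ofRealC0 (f + g) = ofRealC0 f + ofRealC0 g := by
          ext x
          simp [ofRealC0_apply]
        rw [h, map_add, add_apply, inner_add_right, Complex.add_re]
      map_smul' c f := by
        have h : ofRealC0 (c • f) = (c : ℂ) • ofRealC0 f := by
          ext x
          simp [ofRealC0_apply]
        rw [h, map_smul, smul_apply, inner_smul_right, Complex.re_ofReal_mul]
        rfl }
    (by
      intro f hf
      -- Positivity: `f` is the square of `√f`, which is again compactly supported, so the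
      -- functional takes the value `‖ρ(√f)ξ‖²`.
      set g : C_c(X, ℝ) := f.compLeft ⟨Real.sqrt, Real.continuous_sqrt⟩ with hg
      have h : f = g * g := by
        ext x
        have h1 : g x = Real.sqrt (f x) :=
          CompactlySupportedContinuousMap.compLeft_apply Real.sqrt_zero f x
        change f x = g x * g x
        rw [h1, Real.mul_self_sqrt (hf x)]
      change 0 ≤ (inner ℂ ξ (ρ (ofRealC0 f) ξ)).re
      rw [h, inner_map_mul_self]
      positivity)

theorem vectorState_apply (ρ : C₀(X, ℂ) →⋆ₙₐ[ℂ] (H →L[ℂ] H)) (ξ : H) (f : C_c(X, ℝ)) :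
    vectorState ρ ξ f = (inner ℂ ξ (ρ (ofRealC0 f) ξ)).re := rfl

variable [ProperSpace X]

/-- An increasing approximate unit for the functions that vanish off the open set `U`. -/
theorem exists_cutoffs {U : Set X} (hU : IsOpen U) :
    ∃ (C : ℕ → Set X) (φ : ℕ → C_c(X, ℝ)), Monotone C ∧ (⋃ n, C n = U) ∧
      (∀ n, IsCompact (C n)) ∧ (∀ S ⊆ U, IsCompact S → ∃ n, S ⊆ C n) ∧
      (∀ n x, 0 ≤ φ n x ∧ φ n x ≤ 1) ∧ (∀ n, ∀ x ∈ C n, φ n x = 1) ∧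
      (∀ n, ∀ x ∉ U, φ n x = 0) := by
  have : LocallyCompactSpace U := hU.locallyCompactSpace
  have : SigmaCompactSpace U := inferInstance
  let K : CompactExhaustion U := CompactExhaustion.choice U
  have hsub : ∀ n, (↑) '' K n ⊆ U := by
    rintro n _ ⟨x, _, rfl⟩
    exact x.2
  have hcp : ∀ n, IsCompact ((↑) '' K n : Set X) := fun n =>
    (K.isCompact n).image continuous_subtype_val
  choose f hf1 hfc hfU hf01 using fun n =>
    exists_continuousMap_one_of_isCompact_subset_isOpen (hcp n) hU (hsub n)
  refine ⟨fun n => (↑) '' K n, fun n => ⟨f n, hfc n⟩, fun m n h => image_mono (K.subset h), ?_,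
    hcp, ?_, fun n x => ⟨(hf01 n x).1, (hf01 n x).2⟩, fun n x hx => hf1 n hx, fun n x hx => ?_⟩
  · rw [← image_iUnion, K.iUnion_eq, image_univ, Subtype.range_coe]
  · intro S hS hSc
    obtain ⟨n, hn⟩ := K.exists_superset_of_isCompact
      ((Topology.IsInducing.subtypeVal.isCompact_preimage_iff
        (by rwa [Subtype.range_coe])).mpr hSc)
    exact ⟨n, fun x hx => ⟨⟨x, hS hx⟩, hn (mem_preimage.mpr hx), rfl⟩⟩
  · exact image_eq_zero_of_notMem_tsupport fun h => hx (hfU n h)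

theorem openSubspace_mono (ρ : C₀(X, ℂ) →⋆ₙₐ[ℂ] (H →L[ℂ] H)) {U V : Set X} (h : U ⊆ V) :
    openSubspace ρ U ≤ openSubspace ρ V := by
  refine Submodule.closure_le.mpr (le_trans (Submodule.span_mono ?_)
    (Submodule.le_topologicalClosure _))
  rintro η ⟨f, ξ, hf, rfl⟩
  exact ⟨f, ξ, fun x hx => hf x fun hU => hx (h hU), rfl⟩

theorem map_mem_openSubspace (ρ : C₀(X, ℂ) →⋆ₙₐ[ℂ] (H →L[ℂ] H)) {U : Set X} {f : C₀(X, ℂ)}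
    (hf : ∀ x ∉ U, f x = 0) (ξ : H) : ρ f ξ ∈ openSubspace ρ U :=
  Submodule.le_topologicalClosure _ (Submodule.subset_span ⟨f, ξ, hf, rfl⟩)

/-- A closed condition holds on `openSubspace ρ U` as soon as it holds on the vectors `ρ(f)ξ`. -/
theorem eqOn_openSubspace {F : Type*} [NormedAddCommGroup F] [NormedSpace ℂ F]
    (ρ : C₀(X, ℂ) →⋆ₙₐ[ℂ] (H →L[ℂ] H)) {U : Set X} {S T : H →L[ℂ] F}
    (h : ∀ (f : C₀(X, ℂ)) (ξ : H), (∀ x ∉ U, f x = 0) → S (ρ f ξ) = T (ρ f ξ)) {η : H}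
    (hη : η ∈ openSubspace ρ U) : S η = T η := by
  have hle : openSubspace ρ U ≤ ⟨LinearMap.eqLocus (S : H →ₗ[ℂ] F) (T : H →ₗ[ℂ] F),
      isClosed_eq S.continuous T.continuous⟩ := by
    refine Submodule.closure_le.mpr (Submodule.span_le.mpr ?_)
    rintro _ ⟨f, ξ, hf, rfl⟩
    exact h f ξ hf
  exact hle hη

/-- The set where `‖f‖ ≥ ε / 2` is a compact subset of `U`, so the cutoffs are eventually 1 there;
elsewhere the error is at most `‖f‖`, since `|φ n - 1| ≤ 1`. -/
theorem tendsto_norm_cutoff_mul {U : Set X} {C : ℕ → Set X} {φ : ℕ → C_c(X, ℝ)}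
    (hm : Monotone C) (hS : ∀ S ⊆ U, IsCompact S → ∃ n, S ⊆ C n)
    (h01 : ∀ n x, 0 ≤ φ n x ∧ φ n x ≤ 1) (h1 : ∀ n, ∀ x ∈ C n, φ n x = 1)
    {f : C₀(X, ℂ)} (hf : ∀ x ∉ U, f x = 0) :
    Tendsto (fun n => ofRealC0 (φ n) * f) atTop (𝓝 f) := by
  rw [Metric.tendsto_atTop]
  intro ε hε
  have hc : IsCompact {x | ε / 2 ≤ ‖f x‖} := by
    have h := (zero_at_infty f).norm
    rw [norm_zero] at h
    have h2 := h.eventually (gt_mem_nhds (half_pos hε))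
    obtain ⟨t, ht, hts⟩ := mem_cocompact.mp h2
    refine ht.of_isClosed_subset (isClosed_le continuous_const f.continuous.norm) fun x hx => ?_
    by_contra hxt
    exact absurd (show ‖f x‖ < ε / 2 from hts hxt) (not_lt.mpr hx)
  obtain ⟨n, hn⟩ := hS _ (fun x hx => by
    by_contra hxU
    rw [mem_ofPred_eq, hf x hxU, norm_zero] at hx
    linarith) hc
  refine ⟨n, fun m hnm => ?_⟩
  refine lt_of_le_of_lt ?_ (half_lt_self hε)
  rw [← ZeroAtInftyContinuousMap.dist_toBCF_eq_dist]
  refine (BoundedContinuousFunction.dist_le (half_pos hε).le).mpr fun x => ?_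
  change dist ((φ m x : ℂ) * f x) (f x) ≤ ε / 2
  by_cases hx : x ∈ C m
  · rw [h1 m x hx, Complex.ofReal_one, one_mul, dist_self]
    positivity
  · have hx' : ‖f x‖ ≤ ε / 2 := by
      by_contra! h
      exact hx (hm hnm (hn h.le))
    have h3 : (φ m x : ℂ) * f x - f x = ((φ m x - 1 : ℝ) : ℂ) * f x := by
      push_cast
      ring
    rw [dist_eq_norm, h3, norm_mul, Complex.norm_real]
    have h4 : ‖φ m x - 1‖ ≤ 1 := by
      rw [Real.norm_eq_abs, abs_le]
      constructor <;> linarith [(h01 m x).1, (h01 m x).2]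
    calc _ ≤ 1 * (ε / 2) := by gcongr
      _ = _ := one_mul _

theorem continuous_map (ρ : C₀(X, ℂ) →⋆ₙₐ[ℂ] (H →L[ℂ] H)) : Continuous ρ :=
  AddMonoidHomClass.continuous_of_bound ρ 1 fun f => by
    rw [one_mul]
    exact NonUnitalStarAlgHom.norm_apply_le ρ f

theorem norm_map_le_one (ρ : C₀(X, ℂ) →⋆ₙₐ[ℂ] (H →L[ℂ] H)) {f : C_c(X, ℝ)}
    (hf : ∀ x, 0 ≤ f x ∧ f x ≤ 1) : ‖ρ (ofRealC0 f)‖ ≤ 1 := by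
  refine (NonUnitalStarAlgHom.norm_apply_le ρ _).trans ?_
  have h : ‖(ofRealC0 f).toBCF‖ ≤ 1 := by
    refine (BoundedContinuousFunction.norm_le zero_le_one).mpr fun x => ?_
    change ‖(f x : ℂ)‖ ≤ 1
    rw [Complex.norm_real, Real.norm_of_nonneg (hf x).1]
    exact (hf x).2
  exact h

/-- Norm convergence of `φ n * f` to `f` settles the vectors `ρ(f)ζ`, linearity their span, and the
uniform bound `‖ρ(φ n)‖ ≤ 1` the closure. -/
theorem tendsto_map_cutoff {U : Set X} {C : ℕ → Set X} {φ : ℕ → C_c(X, ℝ)}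
    (hm : Monotone C) (hS : ∀ S ⊆ U, IsCompact S → ∃ n, S ⊆ C n)
    (h01 : ∀ n x, 0 ≤ φ n x ∧ φ n x ≤ 1) (h1 : ∀ n, ∀ x ∈ C n, φ n x = 1)
    (ρ : C₀(X, ℂ) →⋆ₙₐ[ℂ] (H →L[ℂ] H)) {η : H} (hη : η ∈ openSubspace ρ U) :
    Tendsto (fun n => ρ (ofRealC0 (φ n)) η) atTop (𝓝 η) := by
  have hη' : η ∈ closure (Submodule.span ℂ {η : H | ∃ (f : C₀(X, ℂ)) (ξ : H),
    (∀ x ∉ U, f x = 0) ∧ η = ρ f ξ} : Set H) := hη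
  have hspan : ∀ ζ ∈ Submodule.span ℂ {η : H | ∃ (f : C₀(X, ℂ)) (ξ : H),
      (∀ x ∉ U, f x = 0) ∧ η = ρ f ξ},
      Tendsto (fun n => ρ (ofRealC0 (φ n)) ζ) atTop (𝓝 ζ) := by
    intro ζ hζ
    induction hζ using Submodule.span_induction with
    | zero => simp
    | add x y _ _ hx hy => simpa only [map_add] using hx.add hy
    | smul c x _ hx => simpa only [map_smul] using hx.const_smul c
    | mem x hx =>
      obtain ⟨f, ζ, hf, rfl⟩ := hx
      have h2 := tendsto_norm_cutoff_mul hm hS h01 h1 hf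
      have h3 : Continuous fun g : C₀(X, ℂ) => ρ g ζ :=
        (continuous_map ρ).clm_apply continuous_const
      have h4 := (h3.tendsto f).comp h2
      refine h4.congr fun n => ?_
      simp only [Function.comp_apply, map_mul, mul_apply_eq_comp]
  rw [Metric.tendsto_atTop]
  intro ε hε
  obtain ⟨ζ, hζ, hd⟩ := Metric.mem_closure_iff.mp hη' (ε / 3) (by positivity)
  obtain ⟨N, hN⟩ := Metric.tendsto_atTop.mp (hspan ζ hζ) (ε / 3) (by positivity)
  refine ⟨N, fun n hn => ?_⟩
  have a1 : dist (ρ (ofRealC0 (φ n)) η) (ρ (ofRealC0 (φ n)) ζ) < ε / 3 := by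
    rw [dist_eq_norm, ← map_sub]
    refine lt_of_le_of_lt ((ρ (ofRealC0 (φ n))).le_of_opNorm_le
      (norm_map_le_one ρ (h01 n)) _) ?_
    rwa [one_mul, ← dist_eq_norm]
  have a2 := hN n hn
  have a3 := dist_triangle4 (ρ (ofRealC0 (φ n)) η) (ρ (ofRealC0 (φ n)) ζ) ζ η
  rw [dist_comm ζ η] at a3
  linarith

variable [MeasurableSpace X] [BorelSpace X]

/-- The scalar spectral measure of the vector `ξ`. -/
def vectorMeasure (ρ : C₀(X, ℂ) →⋆ₙₐ[ℂ] (H →L[ℂ] H)) (ξ : H) : Measure X :=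
  RealRMK.rieszMeasure (vectorState ρ ξ)

instance (ρ : C₀(X, ℂ) →⋆ₙₐ[ℂ] (H →L[ℂ] H)) (ξ : H) : (vectorMeasure ρ ξ).Regular :=
  RealRMK.regular_rieszMeasure _

theorem integral_vectorMeasure (ρ : C₀(X, ℂ) →⋆ₙₐ[ℂ] (H →L[ℂ] H)) (ξ : H) (f : C_c(X, ℝ)) :
    ∫ x, f x ^ 2 ∂vectorMeasure ρ ξ = ‖ρ (ofRealC0 f) ξ‖ ^ 2 := by
  rw [← inner_map_mul_self, ← vectorState_apply, ← RealRMK.integral_rieszMeasure]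
  simp only [pow_two]
  rfl

theorem lintegral_vectorMeasure (ρ : C₀(X, ℂ) →⋆ₙₐ[ℂ] (H →L[ℂ] H)) (ξ : H) (f : C_c(X, ℝ)) :
    ∫⁻ x, ENNReal.ofReal (f x ^ 2) ∂vectorMeasure ρ ξ =
      ENNReal.ofReal (‖ρ (ofRealC0 f) ξ‖ ^ 2) := by
  rw [← integral_vectorMeasure]
  refine (ofReal_integral_eq_lintegral_ofReal ?_ (Eventually.of_forall fun x => by positivity)).symm
  have h : (fun x => f x ^ 2) = (f * f : C_c(X, ℝ)) := by
    ext x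
    simp [pow_two]
  rw [h]
  exact (f * f).continuous.integrable_of_hasCompactSupport (f * f).hasCompactSupport

/-- The integral of `φ n ^ 2` is `‖ρ(φ n)ξ‖²`. It is squeezed between the measures of `C n` and `U`,
and it tends to `‖P ξ‖²` because the cutoffs converge strongly to the identity on the range of `P`.
-/
theorem vectorMeasure_of_isOpen (ρ : C₀(X, ℂ) →⋆ₙₐ[ℂ] (H →L[ℂ] H)) (ξ : H) {U : Set X}
    (hU : IsOpen U) :
    vectorMeasure ρ ξ U =
      ENNReal.ofReal (‖(openSubspace ρ U).toSubmodule.starProjection ξ‖ ^ 2) := by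
  obtain ⟨C, φ, hm, hCU, hCc, hS, h01, h1, h0⟩ := exists_cutoffs hU
  set P := (openSubspace ρ U).toSubmodule.starProjection with hP
  have hPξ : P ξ ∈ openSubspace ρ U := Submodule.starProjection_apply_mem _ _
  -- The self-adjoint operator `ρ(φ n)` has its range in that of `P`, so it kills `ξ - P ξ`.
  have hstep : ∀ n, ρ (ofRealC0 (φ n)) ξ = ρ (ofRealC0 (φ n)) (P ξ) := by
    intro n
    rw [← sub_eq_zero, ← map_sub]
    refine ext_inner_right ℂ fun ζ => ?_
    rw [inner_map_ofRealC0_left, inner_zero_left]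
    refine Submodule.starProjection_inner_eq_zero _ _ ?_
    exact map_mem_openSubspace ρ (fun x hx => by rw [ofRealC0_apply, h0 n x hx]; rfl) ζ
  have hlim : Tendsto (fun n => ENNReal.ofReal (‖ρ (ofRealC0 (φ n)) ξ‖ ^ 2)) atTop
      (𝓝 (ENNReal.ofReal (‖P ξ‖ ^ 2))) := by
    refine (ENNReal.continuous_ofReal.tendsto _).comp ?_
    simp only [hstep]
    exact ((tendsto_map_cutoff hm hS h01 h1 ρ hPξ).norm).pow 2
  refine tendsto_nhds_unique ?_ hlim
  have hCm : Tendsto (fun n => vectorMeasure ρ ξ (C n)) atTop (𝓝 (vectorMeasure ρ ξ U)) := by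
    have := tendsto_measure_iUnion_atTop (μ := vectorMeasure ρ ξ) hm
    rwa [hCU] at this
  refine tendsto_of_tendsto_of_tendsto_of_le_of_le hCm tendsto_const_nhds (fun n => ?_)
    fun n => ?_
  · change _ ≤ ENNReal.ofReal (‖ρ (ofRealC0 (φ n)) ξ‖ ^ 2)
    rw [← lintegral_vectorMeasure, ← lintegral_indicator_one (hCc n).isClosed.measurableSet]
    refine lintegral_mono fun x => ?_
    by_cases hx : x ∈ C n
    · simp [hx, h1 n x hx]
    · simp [hx]
  · change ENNReal.ofReal (‖ρ (ofRealC0 (φ n)) ξ‖ ^ 2) ≤ _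
    rw [← lintegral_vectorMeasure, ← lintegral_indicator_one hU.measurableSet]
    refine lintegral_mono fun x => ?_
    by_cases hx : x ∈ U
    · simp only [hx, indicator_of_mem, Pi.one_apply]
      rw [ENNReal.ofReal_le_one]
      have := h01 n x
      nlinarith
    · simp [hx, h0 n x hx]

/-- Both sides are limits along the open neighbourhoods of `E`: the left by outer regularity, the
right by strong convergence of decreasing projections. Hence `E` may be arbitrary. -/
theorem vectorMeasure_eq (ρ : C₀(X, ℂ) →⋆ₙₐ[ℂ] (H →L[ℂ] H)) (ξ : H) (E : Set X) :
    vectorMeasure ρ ξ E = ENNReal.ofReal (‖chi ρ E ξ‖ ^ 2) := by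
  -- In the dual order `atTop` means shrinking neighbourhoods; intersections make it directed.
  let S : (({U : Set X // IsOpen U ∧ E ⊆ U})ᵒᵈ) → ClosedSubmodule ℂ H := fun U =>
    openSubspace ρ (OrderDual.ofDual U).1
  have hS : Antitone S := fun U V h => openSubspace_mono ρ h
  have h1 := tendsto_starProjection_iInf hS ξ
  have hne : Nonempty (({U : Set X // IsOpen U ∧ E ⊆ U})ᵒᵈ) := ⟨⟨univ, isOpen_univ, subset_univ _⟩⟩
  have hdir : IsDirectedOrder (({U : Set X // IsOpen U ∧ E ⊆ U})ᵒᵈ) :=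
    ⟨fun U V => ⟨⟨U.1 ∩ V.1, U.2.1.inter V.2.1, subset_inter U.2.2 V.2.2⟩, inter_subset_left,
      inter_subset_right⟩⟩
  have h2 : Tendsto (fun U : ({U : Set X // IsOpen U ∧ E ⊆ U})ᵒᵈ =>
      vectorMeasure ρ ξ (OrderDual.ofDual U).1) atTop
      (𝓝 (ENNReal.ofReal (‖chi ρ E ξ‖ ^ 2))) := by
    have h3 := (ENNReal.continuous_ofReal.tendsto _).comp ((h1.norm).pow 2)
    refine h3.congr fun U => ?_
    exact (vectorMeasure_of_isOpen ρ ξ (OrderDual.ofDual U).2.1).symm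
  refine tendsto_nhds_unique ?_ h2
  have h4 : Antitone fun U : (({U : Set X // IsOpen U ∧ E ⊆ U})ᵒᵈ) =>
      vectorMeasure ρ ξ (OrderDual.ofDual U).1 := fun U V h => measure_mono h
  have h5 := tendsto_atTop_iInf h4
  convert h5 using 2
  rw [E.measure_eq_iInf_isOpen]
  refine le_antisymm (le_iInf fun U => ?_) (le_iInf₂ fun U hEU => le_iInf fun hU => ?_)
  · exact iInf₂_le_of_le U.1 U.2.2 (iInf_le _ U.2.1)
  · exact iInf_le_of_le (OrderDual.toDual ⟨U, hU, hEU⟩) le_rfl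

end Spectral

/-! ### The calculus of the projections `chi` -/

section Chi

variable {X : Type*} [MetricSpace X]
variable {H : Type*} [NormedAddCommGroup H] [InnerProductSpace ℂ H] [CompleteSpace H]

theorem chi_mul_self (ρ : C₀(X, ℂ) →⋆ₙₐ[ℂ] (H →L[ℂ] H)) (E : Set X) :
    chi ρ E * chi ρ E = chi ρ E :=
  Submodule.isIdempotentElem_starProjection _

theorem norm_chi_le (ρ : C₀(X, ℂ) →⋆ₙₐ[ℂ] (H →L[ℂ] H)) (E : Set X) : ‖chi ρ E‖ ≤ 1 :=
  Submodule.starProjection_norm_le _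

theorem chi_mul_of_subset (ρ : C₀(X, ℂ) →⋆ₙₐ[ℂ] (H →L[ℂ] H)) {E F : Set X} (h : E ⊆ F) :
    chi ρ E * chi ρ F = chi ρ E := by
  refine Submodule.starProjection_comp_starProjection_of_le ?_
  refine ClosedSubmodule.toSubmodule_le_toSubmodule.mpr (le_iInf fun U => ?_)
  exact iInf_le_of_le ⟨U.1, U.2.1, h.trans U.2.2⟩ le_rfl

theorem chi_mul_of_superset (ρ : C₀(X, ℂ) →⋆ₙₐ[ℂ] (H →L[ℂ] H)) {E F : Set X} (h : E ⊆ F) :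
    chi ρ F * chi ρ E = chi ρ E := by
  have := congrArg star (chi_mul_of_subset ρ h)
  rwa [star_mul, star_chi, star_chi] at this

theorem chi_apply_mem (ρ : C₀(X, ℂ) →⋆ₙₐ[ℂ] (H →L[ℂ] H)) {E U : Set X} (hU : IsOpen U)
    (h : E ⊆ U) (ξ : H) : chi ρ E ξ ∈ openSubspace ρ U := by
  have h1 : chi ρ E ξ ∈ ⨅ U : {U : Set X // IsOpen U ∧ E ⊆ U}, openSubspace ρ U.1 :=
    Submodule.starProjection_apply_mem _ _
  exact ClosedSubmodule.mem_iInf.mp h1 ⟨U, hU, h⟩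

variable [ProperSpace X]

theorem chi_mul_map (ρ : C₀(X, ℂ) →⋆ₙₐ[ℂ] (H →L[ℂ] H)) {E : Set X} {f : C₀(X, ℂ)}
    (hf : ∀ x ∉ E, f x = 0) : chi ρ E * ρ f = ρ f := by
  ext ξ
  refine Submodule.starProjection_eq_self_iff.mpr ?_
  refine ClosedSubmodule.mem_iInf.mpr fun U => ?_
  exact map_mem_openSubspace ρ (fun x hx => hf x fun h => hx (U.2.2 h)) ξ

/-- If `k` vanishes off `U` then `f * k = k`, so `ρ f` fixes the generators of the open subspace of
`U`, which contains the range of `chi ρ E`. -/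
theorem map_mul_chi_eq_self (ρ : C₀(X, ℂ) →⋆ₙₐ[ℂ] (H →L[ℂ] H)) {E U : Set X} (hU : IsOpen U)
    (h : E ⊆ U) {f : C₀(X, ℂ)} (hf : ∀ x ∈ U, f x = 1) : ρ f * chi ρ E = chi ρ E := by
  ext ξ
  refine eqOn_openSubspace ρ (S := ρ f) (T := 1) (fun k ζ hk => ?_) (chi_apply_mem ρ hU h ξ)
  have h1 : f * k = k := by
    ext x
    by_cases hx : x ∈ U
    · simp [hf x hx]
    · simp [hk x hx]
  change (ρ f * ρ k) ζ = ρ k ζ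
  rw [← map_mul, h1]

theorem chi_apply_eq_zero_iff [MeasurableSpace X] [BorelSpace X]
    {ρ : C₀(X, ℂ) →⋆ₙₐ[ℂ] (H →L[ℂ] H)} {E : Set X} {ξ : H} :
    chi ρ E ξ = 0 ↔ vectorMeasure ρ ξ E = 0 := by
  rw [vectorMeasure_eq, ENNReal.ofReal_eq_zero]
  refine ⟨fun h => by simp [h], fun h => ?_⟩
  have h2 : ‖chi ρ E ξ‖ = 0 := by nlinarith [norm_nonneg (chi ρ E ξ)]
  simpa using h2

theorem chi_empty (ρ : C₀(X, ℂ) →⋆ₙₐ[ℂ] (H →L[ℂ] H)) : chi ρ (∅ : Set X) = 0 := by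
  borelize X
  ext ξ
  exact chi_apply_eq_zero_iff.mpr MeasureTheory.measure_empty

/-- Non-degeneracy says that the open subspace belonging to the whole space is all of `H`. -/
theorem vectorMeasure_univ [MeasurableSpace X] [BorelSpace X]
    {ρ : C₀(X, ℂ) →⋆ₙₐ[ℂ] (H →L[ℂ] H)}
    (hρ : (Submodule.span ℂ {η : H | ∃ (f : C₀(X, ℂ)) (ξ : H), η = ρ f ξ}).topologicalClosure = ⊤)
    (ξ : H) : vectorMeasure ρ ξ univ = ENNReal.ofReal (‖ξ‖ ^ 2) := by
  rw [vectorMeasure_of_isOpen ρ ξ isOpen_univ]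
  congr 3
  refine Submodule.starProjection_eq_self_iff.mpr ?_
  have h : ξ ∈ (Submodule.span ℂ
      {η : H | ∃ (f : C₀(X, ℂ)) (ξ : H), η = ρ f ξ}).topologicalClosure := by
    rw [hρ]
    trivial
  refine Submodule.topologicalClosure_mono (Submodule.span_mono ?_) h
  rintro η ⟨f, ξ, rfl⟩
  exact ⟨f, ξ, fun x hx => absurd (mem_univ x) hx, rfl⟩

/-- The measure of a vector in the range of `chi ρ F` has all its mass on `F`, so the complement of
`F`, and `E` inside it, is null. -/
theorem chi_mul_chi_of_disjoint {ρ : C₀(X, ℂ) →⋆ₙₐ[ℂ] (H →L[ℂ] H)}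
    (hρ : (Submodule.span ℂ {η : H | ∃ (f : C₀(X, ℂ)) (ξ : H), η = ρ f ξ}).topologicalClosure = ⊤)
    {E F : Set X} (hF : @MeasurableSet X (borel X) F) (hd : Disjoint E F) :
    chi ρ E * chi ρ F = 0 := by
  borelize X
  ext ξ
  refine chi_apply_eq_zero_iff.mpr ?_
  have h1 : vectorMeasure ρ (chi ρ F ξ) F = vectorMeasure ρ (chi ρ F ξ) univ := by
    rw [vectorMeasure_univ hρ, vectorMeasure_eq, ← mul_apply_eq_comp, chi_mul_self]
  have h2 : vectorMeasure ρ (chi ρ F ξ) Fᶜ = 0 := by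
    rw [MeasureTheory.measure_compl hF, h1, tsub_self]
    rw [h1, vectorMeasure_univ hρ]
    exact ENNReal.ofReal_ne_top
  exact MeasureTheory.measure_mono_null hd.subset_compl_right h2

/-- The projections of a countable Borel partition are a resolution. -/
theorem isResolution_chi {ρ : C₀(X, ℂ) →⋆ₙₐ[ℂ] (H →L[ℂ] H)}
    (hρ : (Submodule.span ℂ {η : H | ∃ (f : C₀(X, ℂ)) (ξ : H), η = ρ f ξ}).topologicalClosure = ⊤)
    {ι : Type*} [Countable ι] {E : ι → Set X} (hE : ∀ i, @MeasurableSet X (borel X) (E i))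
    (hd : ∀ i j, i ≠ j → Disjoint (E i) (E j)) (hu : ⋃ i, E i = univ) :
    IsResolution fun i => chi ρ (E i) := by
  refine ⟨fun i => star_chi ρ _, fun i => chi_mul_self ρ _, fun i j hij =>
    chi_mul_chi_of_disjoint hρ (hE j) (hd i j hij), fun ξ hξ => ?_⟩
  borelize X
  -- A vector killed by all the projections sees only null pieces; there are countably many, so its
  -- total mass `‖ξ‖²` vanishes.
  have h1 : vectorMeasure ρ ξ univ = 0 := by
    rw [← hu, MeasureTheory.measure_iUnion_null_iff]
    exact fun i => chi_apply_eq_zero_iff.mp (hξ i)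
  rw [vectorMeasure_univ hρ, ENNReal.ofReal_eq_zero] at h1
  have h2 : ‖ξ‖ = 0 := by nlinarith [norm_nonneg ξ]
  simpa using h2

end Chi

/-! ### Tensor products of operators and of resolutions -/

section TensorOp

variable {H : Type*} [NormedAddCommGroup H] [InnerProductSpace ℂ H] [CompleteSpace H]
variable {K : Type*} [NormedAddCommGroup K] [InnerProductSpace ℂ K] [CompleteSpace K]

theorem tensorOp_zero (B : K →L[ℂ] K) : tensorOp (0 : H →L[ℂ] H) B = 0 := by
  have := tensorOp_smul (0 : ℂ) (0 : H →L[ℂ] H) B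
  simpa using this

theorem tensorOp_sub_right (A : H →L[ℂ] H) (B B' : K →L[ℂ] K) :
    tensorOp A (B - B') = tensorOp A B - tensorOp A B' := by
  refine tensorOp_ext fun z => ?_
  rw [sub_apply, tensorOp_coe, tensorOp_coe, tensorOp_coe, ← map_sub, ← LinearMap.sub_apply]
  congr 2
  refine TensorProduct.ext' fun x y => ?_
  simp [TensorProduct.tmul_sub]

theorem norm_tensorOp_le (A : H →L[ℂ] H) (B : K →L[ℂ] K) : ‖tensorOp A B‖ ≤ ‖A‖ * ‖B‖ := by
  refine ContinuousLinearMap.opNorm_le_bound _ (by positivity) fun z => ?_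
  refine denseRange_toHilbertTensor.induction_on z
    (isClosed_le (by fun_prop) (by fun_prop)) fun z => ?_
  rw [tensorOp_coe, LinearIsometry.norm_map, LinearIsometry.norm_map]
  exact norm_map_le A B z

/-- Only completeness needs an argument: a vector killed by all `P i ⊗ 1` is orthogonal to every `P
i ξ ⊗ k`, hence by summation over `i` to every `ξ ⊗ k`, and these span a dense subspace. -/
theorem IsResolution.tensorOp {ι : Type*} {P : ι → H →L[ℂ] H} (hP : IsResolution P) :
    IsResolution fun i => tensorOp (P i) (1 : K →L[ℂ] K) where
  star_eq i := by
    rw [← tensorOp_star, hP.star_eq, star_one]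
  mul_self i := by
    rw [← tensorOp_mul, hP.mul_self, one_mul]
  mul_eq_zero i j hij := by
    rw [← tensorOp_mul, hP.mul_eq_zero i j hij, tensorOp_zero]
  eq_zero z hz := by
    have hself : ∀ i, star (StrongQuasiLocal.tensorOp (P i) (1 : K →L[ℂ] K)) =
        StrongQuasiLocal.tensorOp (P i) (1 : K →L[ℂ] K) := fun i => by
      rw [← tensorOp_star, hP.star_eq, star_one]
    have h0 : ∀ (ξ : H) (k : K), inner ℂ z (toHilbertTensor (ξ ⊗ₜ[ℂ] k)) = 0 := by
      intro ξ k
      have hb : ∀ η : H, ‖η ⊗ₜ[ℂ] k‖ ≤ ‖k‖ * ‖η‖ := fun η => by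
        rw [TensorProduct.norm_tmul, mul_comm]
      let S : H →L[ℂ] HilbertTensor H K :=
        toHilbertTensor.toContinuousLinearMap.comp
          (((TensorProduct.mk ℂ H K).flip k).mkContinuous ‖k‖ hb)
      have h1 := (hP.hasSum ξ).mapL ((innerSL ℂ z).comp S)
      have h2 : ∀ i, ((innerSL ℂ z).comp S) (P i ξ) = 0 := by
        intro i
        change inner ℂ z (toHilbertTensor (P i ξ ⊗ₜ[ℂ] k)) = 0
        have h3 : toHilbertTensor (P i ξ ⊗ₜ[ℂ] k) =
            StrongQuasiLocal.tensorOp (P i) (1 : K →L[ℂ] K) (toHilbertTensor (ξ ⊗ₜ[ℂ] k)) := by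
          rw [tensorOp_coe]
          rfl
        rw [h3, ← ContinuousLinearMap.adjoint_inner_left, ← ContinuousLinearMap.star_eq_adjoint,
          hself, hz i, inner_zero_left]
      simp only [h2] at h1
      exact h1.unique hasSum_zero
    refine ext_inner_right ℂ fun w => ?_
    rw [inner_zero_left]
    refine denseRange_toHilbertTensor.induction_on w
      (isClosed_eq (by fun_prop) (by fun_prop)) fun w => ?_
    induction w with
    | zero => simp
    | tmul ξ k => exact h0 ξ k
    | add x y hx hy => rw [map_add, inner_add_right, hx, hy, add_zero]

end TensorOp

/-! ### Existence, uniqueness and continuity of `Λ(g)` -/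

section Lambda

variable {X : Type*} [MetricSpace X] [ProperSpace X]
variable {H : Type*} [NormedAddCommGroup H] [InnerProductSpace ℂ H] [CompleteSpace H]
variable {K : Type*} [NormedAddCommGroup K] [InnerProductSpace ℂ K] [CompleteSpace K]
variable {ρ : C₀(X, ℂ) →⋆ₙₐ[ℂ] (H →L[ℂ] H)}

/-- A bounded family of values on a countable Borel partition defines a block-diagonal
operator. -/
theorem exists_blockDiagonal_chi
    (hρ : (Submodule.span ℂ {η : H | ∃ (f : C₀(X, ℂ)) (ξ : H), η = ρ f ξ}).topologicalClosure = ⊤)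
    {g : X → Compacts K} {E : ℕ → Set X} {a : ℕ → Compacts K} (hE : IsPartitionFor g E a)
    {C : ℝ} (hg : ∀ x, ‖g x‖ ≤ C) : ∃ L, ∀ n,
      L * tensorOp (chi ρ (E n)) 1 = tensorOp (chi ρ (E n)) (a n : K →L[ℂ] K) ∧
      tensorOp (chi ρ (E n)) 1 * L = tensorOp (chi ρ (E n)) (a n : K →L[ℂ] K) := by
  have hres := isResolution_chi hρ hE.measurable hE.disjoint hE.cover
  refine (hres.tensorOp (K := K)).exists_blockDiagonal (C := |C|) (fun n => ?_) (fun n => ?_)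
    fun n => ?_
  · rw [← tensorOp_mul, chi_mul_self, one_mul]
  · rw [← tensorOp_mul, chi_mul_self, mul_one]
  -- On an empty piece `a n` is not a value of `g` and may be large, but there the projection is
  -- zero.
  · rcases (E n).eq_empty_or_nonempty with h | ⟨x, hx⟩
    · rw [h, chi_empty, tensorOp_zero, norm_zero]
      positivity
    · refine (norm_tensorOp_le _ _).trans ?_
      have h1 : ‖(a n : K →L[ℂ] K)‖ ≤ C := by
        have := hg x
        rwa [hE.value n x hx] at this
      calc _ ≤ 1 * |C| := by
            gcongr
            · exact norm_chi_le ρ _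
            · exact h1.trans (le_abs_self C)
        _ = _ := one_mul _

theorem exists_isLambdaCountable
    (hρ : (Submodule.span ℂ {η : H | ∃ (f : C₀(X, ℂ)) (ξ : H), η = ρ f ξ}).topologicalClosure = ⊤)
    {g : X → Compacts K} (h : IsCountablyValued g) {C : ℝ} (hg : ∀ x, ‖g x‖ ≤ C) :
    ∃ L, IsLambdaCountable ρ g L := by
  obtain ⟨E, a, hE⟩ := h
  obtain ⟨L, hL⟩ := exists_blockDiagonal_chi hρ hE hg
  exact ⟨L, E, a, hE, hL⟩

theorem blockDiagonal_of_subset {L : HilbertTensor H K →L[ℂ] HilbertTensor H K}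
    {E F : Set X} (hFE : F ⊆ E) {a : K →L[ℂ] K}
    (h : L * tensorOp (chi ρ E) 1 = tensorOp (chi ρ E) a ∧
      tensorOp (chi ρ E) 1 * L = tensorOp (chi ρ E) a) :
    L * tensorOp (chi ρ F) 1 = tensorOp (chi ρ F) a ∧
      tensorOp (chi ρ F) 1 * L = tensorOp (chi ρ F) a := by
  constructor
  · rw [← chi_mul_of_superset ρ hFE, ← one_mul (1 : K →L[ℂ] K), tensorOp_mul, ← mul_assoc, h.1,
      ← tensorOp_mul, mul_one]
  · rw [← chi_mul_of_subset ρ hFE, ← one_mul (1 : K →L[ℂ] K), tensorOp_mul, mul_assoc, h.2,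
      ← tensorOp_mul, one_mul]

/-- On the common refinement `E m ∩ E' n` the difference is block-diagonal with blocks `1 ⊗ (a m -
a' n)`, and on a nonempty piece this is a value of `g - g'`. -/
theorem IsLambdaCountable.norm_sub_le
    (hρ : (Submodule.span ℂ {η : H | ∃ (f : C₀(X, ℂ)) (ξ : H), η = ρ f ξ}).topologicalClosure = ⊤)
    {g g' : X → Compacts K} {L L' : HilbertTensor H K →L[ℂ] HilbertTensor H K}
    (h : IsLambdaCountable ρ g L) (h' : IsLambdaCountable ρ g' L') {c : ℝ} (hc : 0 ≤ c)
    (hgg : ∀ x, ‖g x - g' x‖ ≤ c) : ‖L - L'‖ ≤ c := by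
  obtain ⟨E, a, hE, hL⟩ := h
  obtain ⟨E', a', hE', hL'⟩ := h'
  borelize X
  have hres : IsResolution fun p : ℕ × ℕ => chi ρ (E p.1 ∩ E' p.2) := by
    refine isResolution_chi hρ (fun p => (hE.measurable p.1).inter (hE'.measurable p.2)) ?_ ?_
    · rintro ⟨m, n⟩ ⟨m', n'⟩ hne
      by_cases hm : m = m'
      · have hn : n ≠ n' := fun hn => hne (by rw [hm, hn])
        exact (hE'.disjoint n n' hn).mono inter_subset_right inter_subset_right
      · exact (hE.disjoint m m' hm).mono inter_subset_left inter_subset_left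
    · refine eq_univ_of_forall fun x => ?_
      obtain ⟨m, hm⟩ := mem_iUnion.mp (hE.cover ▸ mem_univ x)
      obtain ⟨n, hn⟩ := mem_iUnion.mp (hE'.cover ▸ mem_univ x)
      exact mem_iUnion.mpr ⟨(m, n), hm, hn⟩
  have hb : ∀ p : ℕ × ℕ, (L - L') * tensorOp (chi ρ (E p.1 ∩ E' p.2)) 1 =
        tensorOp (chi ρ (E p.1 ∩ E' p.2)) ((a p.1 : K →L[ℂ] K) - (a' p.2 : K →L[ℂ] K)) ∧
      tensorOp (chi ρ (E p.1 ∩ E' p.2)) 1 * (L - L') =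
        tensorOp (chi ρ (E p.1 ∩ E' p.2)) ((a p.1 : K →L[ℂ] K) - (a' p.2 : K →L[ℂ] K)) := by
    intro p
    obtain ⟨h1, h2⟩ := blockDiagonal_of_subset (inter_subset_left (t := E' p.2)) (hL p.1)
    obtain ⟨h1', h2'⟩ := blockDiagonal_of_subset (inter_subset_right (s := E p.1)) (hL' p.2)
    rw [sub_mul, mul_sub, h1, h2, h1', h2', tensorOp_sub_right]
    exact ⟨rfl, rfl⟩
  refine (hres.tensorOp (K := K)).norm_le hc (fun p => (hb p).2.trans (hb p).1.symm) fun p => ?_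
  rw [(hb p).1]
  rcases (E p.1 ∩ E' p.2).eq_empty_or_nonempty with h | ⟨x, hx, hx'⟩
  · rw [h, chi_empty, tensorOp_zero, norm_zero]
    exact hc
  · refine (norm_tensorOp_le _ _).trans ?_
    have h1 : ‖(a p.1 : K →L[ℂ] K) - (a' p.2 : K →L[ℂ] K)‖ ≤ c := by
      have := hgg x
      rwa [hE.value _ x hx, hE'.value _ x hx'] at this
    calc _ ≤ 1 * c := by
          gcongr
          exact norm_chi_le ρ _
      _ = _ := one_mul _

/-- The countably-valued estimate survives uniform limits. With `c = 0` it shows that `Λ(g)` is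
unique. -/
theorem IsLambda.norm_sub_le
    (hρ : (Submodule.span ℂ {η : H | ∃ (f : C₀(X, ℂ)) (ξ : H), η = ρ f ξ}).topologicalClosure = ⊤)
    {g g' : X → Compacts K} {L L' : HilbertTensor H K →L[ℂ] HilbertTensor H K}
    (h : IsLambda ρ g L) (h' : IsLambda ρ g' L') {c : ℝ} (hc : 0 ≤ c)
    (hgg : ∀ x, ‖g x - g' x‖ ≤ c) : ‖L - L'‖ ≤ c := by
  obtain ⟨u, M, hM, hu, hL⟩ := h
  obtain ⟨u', M', hM', hu', hL'⟩ := h'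
  refine le_of_forall_pos_le_add fun ε hε => ?_
  refine le_of_tendsto (hL.sub hL').norm ?_
  filter_upwards [Metric.tendstoUniformly_iff.mp hu (ε / 2) (by positivity),
    Metric.tendstoUniformly_iff.mp hu' (ε / 2) (by positivity)] with k h1 h2
  refine (hM k).norm_sub_le hρ (hM' k) (by positivity) fun x => ?_
  have h3 := h1 x
  have h4 := h2 x
  rw [dist_eq_norm] at h3 h4
  have h5 : u k x - u' k x = -(g x - u k x) + (g x - g' x) + (g' x - u' k x) := by abel
  rw [h5]
  refine (norm_add₃_le).trans ?_
  rw [norm_neg]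
  linarith [hgg x]

theorem IsLambdaCountable.isLambda {g : X → Compacts K}
    {L : HilbertTensor H K →L[ℂ] HilbertTensor H K} (h : IsLambdaCountable ρ g L) :
    IsLambda ρ g L := by
  refine ⟨fun _ => g, fun _ => L, fun _ => h, ?_, tendsto_const_nhds⟩
  rw [Metric.tendstoUniformly_iff]
  intro ε hε
  exact Eventually.of_forall fun _ x => by rwa [dist_self]

theorem IsLambda.lambda_eq
    (hρ : (Submodule.span ℂ {η : H | ∃ (f : C₀(X, ℂ)) (ξ : H), η = ρ f ξ}).topologicalClosure = ⊤)
    {g : X → Compacts K} {L : HilbertTensor H K →L[ℂ] HilbertTensor H K} (h : IsLambda ρ g L) :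
    Lambda ρ g = L := by
  refine Lambda_eq ⟨L, h, fun L' h' => ?_⟩ h
  rw [← sub_eq_zero, ← norm_le_zero_iff]
  exact h'.norm_sub_le hρ h le_rfl fun x => by rw [sub_self, norm_zero]

/-- A strongly measurable map is a uniform limit of countably-valued maps. -/
theorem IsStronglyMeasurable.exists_near {g : X → Compacts K} (hg : IsStronglyMeasurable g)
    {ε : ℝ} (hε : 0 < ε) : ∃ v, IsCountablyValued v ∧ ∀ x, ‖g x - v x‖ < ε := by
  obtain ⟨u, hu, hlim⟩ := hg
  choose E a hE using hu
  borelize X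
  -- All values of all approximants in one sequence. Each `x` is sent to a `d n` within `ε` of `g
  -- x`, with the least such `n`; `disjointed` makes the choice Borel.
  let d : ℕ → Compacts K := fun n => a n.unpair.1 n.unpair.2
  have hmeas : ∀ b : Compacts K, Measurable fun x => ‖g x - b‖ := by
    intro b
    refine measurable_of_tendsto_metrizable (f := fun k x => ‖u k x - b‖) (fun k => ?_)
      (tendsto_pi_nhds.mpr fun x => ((hlim x).sub_const b).norm)
    intro S _
    have h : (fun x => ‖u k x - b‖) ⁻¹' S = ⋃ (n) (_ : ‖a k n - b‖ ∈ S), E k n := by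
      ext x
      obtain ⟨n, hn⟩ := mem_iUnion.mp ((hE k).cover ▸ mem_univ x)
      rw [mem_preimage, (hE k).value n x hn]
      simp only [mem_iUnion, exists_prop]
      refine ⟨fun h => ⟨n, h, hn⟩, fun ⟨m, hm, hxm⟩ => ?_⟩
      rwa [← (hE k).value n x hn, (hE k).value m x hxm]
    rw [h]
    exact MeasurableSet.iUnion fun n => MeasurableSet.iUnion fun _ => (hE k).measurable n
  let F : ℕ → Set X := fun n => {x | ‖g x - d n‖ < ε}
  have hF : ∀ n, MeasurableSet (F n) := fun n => hmeas (d n) measurableSet_Iio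
  have hcov : ⋃ n, disjointed F n = univ := by
    rw [iUnion_disjointed]
    refine eq_univ_of_forall fun x => ?_
    obtain ⟨k, hk⟩ := ((Metric.tendsto_nhds.mp (hlim x)) ε hε).exists
    obtain ⟨n, hn⟩ := mem_iUnion.mp ((hE k).cover ▸ mem_univ x)
    refine mem_iUnion.mpr ⟨Nat.pair k n, ?_⟩
    change ‖g x - a (Nat.pair k n).unpair.1 (Nat.pair k n).unpair.2‖ < ε
    rw [Nat.unpair_pair, ← (hE k).value n x hn, ← dist_eq_norm, dist_comm]
    exact hk
  choose N hN using fun x => mem_iUnion.mp (hcov ▸ mem_univ x : x ∈ ⋃ n, disjointed F n)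
  refine ⟨fun x => d (N x), ⟨disjointed F, d, ⟨fun n => MeasurableSet.disjointed hF n,
    fun m n h => disjoint_disjointed F h, hcov, fun n x hx => ?_⟩⟩,
    fun x => disjointed_subset F _ (hN x)⟩
  by_contra hne
  have hNn : N x ≠ n := fun h => hne (by rw [h])
  exact disjoint_left.mp (disjoint_disjointed F hNn) (hN x) hx

/-- The operator `Λ(g)` of a bounded strongly measurable map. -/
theorem exists_isLambda
    (hρ : (Submodule.span ℂ {η : H | ∃ (f : C₀(X, ℂ)) (ξ : H), η = ρ f ξ}).topologicalClosure = ⊤)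
    {g : X → Compacts K} (hg : IsStronglyMeasurable g) {C : ℝ} (hC : ∀ x, ‖g x‖ ≤ C) :
    ∃ L, IsLambda ρ g L := by
  have hpos : ∀ k : ℕ, (0 : ℝ) < 1 / (k + 1) := fun k => Nat.one_div_pos_of_nat
  choose u hu hug using fun k : ℕ => hg.exists_near (hpos k)
  have hub : ∀ k x, ‖u k x‖ ≤ C + 1 / (k + 1) := by
    intro k x
    have h1 : u k x = g x - (g x - u k x) := by abel
    rw [h1]
    exact (norm_sub_le _ _).trans (add_le_add (hC x) (hug k x).le)
  choose M hM using fun k => exists_isLambdaCountable hρ (hu k) (hub k)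
  have hlim : Tendsto (fun k : ℕ => (1 : ℝ) / (k + 1)) atTop (𝓝 0) :=
    tendsto_one_div_add_atTop_nhds_zero_nat
  -- For `k ≤ l` the approximants differ by at most `2 / (k + 1)`, so the norm estimate makes their
  -- block operators Cauchy.
  have hcau : CauchySeq M := by
    refine cauchySeq_of_le_tendsto_0' (fun k : ℕ => 2 * (1 / ((k : ℝ) + 1))) (fun k l hkl => ?_)
      (by simpa using hlim.const_mul 2)
    rw [dist_eq_norm]
    refine (hM k).norm_sub_le hρ (hM l) (by positivity) fun x => ?_
    have h1 : u k x - u l x = -(g x - u k x) + (g x - u l x) := by abel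
    have h2 : (1 : ℝ) / (l + 1) ≤ 1 / (k + 1) := Nat.one_div_le_one_div hkl
    rw [h1]
    refine (norm_add_le _ _).trans ?_
    rw [norm_neg]
    linarith [hug k x, hug l x]
  obtain ⟨L, hL⟩ := cauchySeq_tendsto_of_complete hcau
  refine ⟨L, u, M, hM, ?_, hL⟩
  rw [Metric.tendstoUniformly_iff]
  intro ε hε
  filter_upwards [hlim.eventually (gt_mem_nhds hε)] with k hk x
  rw [dist_eq_norm]
  exact (hug k x).trans hk

end Lambda

/-! ### Bounded partitions and coarse equivalence -/

section Geometry

/-- `A` is a Borel partition of `X` into uniformly bounded sets around the uniformly separated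
points `p i`, each containing a neighbourhood of its point. -/
structure IsBoundedPartition {X : Type*} [MetricSpace X] {ι : Type*} (p : ι → X)
    (A : ι → Set X) : Prop where
  measurable : ∀ i, @MeasurableSet X (borel X) (A i)
  disjoint : ∀ i j, i ≠ j → Disjoint (A i) (A j)
  cover : ⋃ i, A i = univ
  ball_subset : ∀ i, Metric.ball (p i) (1 / 2) ⊆ A i
  bounded : ∃ C, ∀ i, A i ⊆ Metric.closedBall (p i) C

variable {X Y : Type*} [MetricSpace X] [MetricSpace Y]

theorem countable_of_separated [SecondCountableTopology X] {ι : Type*} {p : ι → X}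
    (hp : ∀ i j, i ≠ j → 1 ≤ dist (p i) (p j)) : Countable ι := by
  refine (Set.PairwiseDisjoint.countable_of_isOpen (s := fun i => Metric.ball (p i) (1 / 2))
    (a := Set.univ) (fun i _ j _ hij => ?_) (fun i _ => Metric.isOpen_ball)
    fun i _ => ⟨p i, Metric.mem_ball_self (by norm_num)⟩) |> Set.countable_univ_iff.mp
  exact Metric.ball_disjoint_ball (by linarith [hp i j hij])

/-- The disjoint balls of radius 1/2 go to their centres; every other point goes to the first index,
in a fixed enumeration, whose closed ball of radius `C` contains it. -/
theorem exists_isBoundedPartition {ι : Type*} [Countable ι] {p : ι → X}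
    (hp : ∀ i j, i ≠ j → 1 ≤ dist (p i) (p j)) {C : ℝ} (hC : ∀ x, ∃ i, dist x (p i) ≤ C) :
    ∃ A : ι → Set X, IsBoundedPartition p A := by
  obtain ⟨e, he⟩ := exists_injective_nat ι
  borelize X
  let B : ι → Set X := fun i => Metric.ball (p i) (1 / 2)
  let D : ι → Set X := fun i => Metric.closedBall (p i) C
  have hB : ∀ i j, i ≠ j → Disjoint (B i) (B j) := fun i j hij =>
    Metric.ball_disjoint_ball (by linarith [hp i j hij])
  refine ⟨fun i => B i ∪ ((D i \ ⋃ j, B j) \ ⋃ (j) (_ : e j < e i), D j), fun i => ?_,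
    fun i j hij => ?_, ?_, fun i => subset_union_left, ⟨max C 1, fun i => ?_⟩⟩
  · refine Metric.isOpen_ball.measurableSet.union (MeasurableSet.diff (MeasurableSet.diff
      Metric.isClosed_closedBall.measurableSet (MeasurableSet.iUnion fun j =>
        Metric.isOpen_ball.measurableSet)) (MeasurableSet.iUnion fun j =>
        MeasurableSet.iUnion fun _ => Metric.isClosed_closedBall.measurableSet))
  · rw [Set.disjoint_left]
    rintro x (hi | ⟨⟨hi, hi'⟩, hi''⟩) (hj | ⟨⟨hj, hj'⟩, hj''⟩)
    · exact disjoint_left.mp (hB i j hij) hi hj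
    · exact hj' (mem_iUnion.mpr ⟨i, hi⟩)
    · exact hi' (mem_iUnion.mpr ⟨j, hj⟩)
    · rcases lt_or_gt_of_ne (he.ne hij) with h | h
      · exact hj'' (mem_iUnion₂.mpr ⟨i, h, hi⟩)
      · exact hi'' (mem_iUnion₂.mpr ⟨j, h, hj⟩)
  · refine eq_univ_of_forall fun x => ?_
    by_cases hx : ∃ i, x ∈ B i
    · obtain ⟨i, hi⟩ := hx
      exact mem_iUnion.mpr ⟨i, Or.inl hi⟩
    · obtain ⟨i, hi, hmin⟩ := WellFounded.has_min (measure e).wf {i | dist x (p i) ≤ C} (hC x)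
      refine mem_iUnion.mpr ⟨i, Or.inr ⟨⟨hi, fun h => hx (mem_iUnion.mp h)⟩, fun h => ?_⟩⟩
      obtain ⟨j, hj, hxj⟩ := mem_iUnion₂.mp h
      exact hmin j hxj hj
  · rintro x (h | h)
    · exact Metric.closedBall_subset_closedBall ((by norm_num : (1 / 2 : ℝ) ≤ 1).trans
        (le_max_right _ _)) (Metric.ball_subset_closedBall h)
    · exact Metric.closedBall_subset_closedBall (le_max_left _ _) h.1.1

/-- Only finitely many pieces of a bounded partition of a proper space meet a bounded set. -/
theorem IsBoundedPartition.finite_meet [ProperSpace X] {ι : Type*} {p : ι → X} {A : ι → Set X}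
    (h : IsBoundedPartition p A) {S : Set X} (hS : Bornology.IsBounded S) :
    {i | (A i ∩ S).Nonempty}.Finite := by
  rcases isEmpty_or_nonempty X with hX | hX
  · have : IsEmpty ι := ⟨fun i => hX.false (p i)⟩
    exact Set.toFinite _
  obtain ⟨C, hC⟩ := h.bounded
  have hb : Bornology.IsBounded (Metric.cthickening C S) := hS.cthickening
  have hc : IsCompact (Metric.cthickening C S) :=
    Metric.isCompact_of_isClosed_isBounded Metric.isClosed_cthickening hb
  obtain ⟨t, -, htf, hcov⟩ := Metric.finite_approx_of_totallyBounded hc.totallyBounded (1 / 2)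
    (by norm_num)
  -- The base points of these pieces lie in a compact thickening of `S`. A point of the finite net
  -- `t` within 1/2 of `p i` lies in `A i`, so distinct pieces get distinct net points.
  have hmem : ∀ i ∈ {i | (A i ∩ S).Nonempty}, ∃ y ∈ t, dist (p i) y < 1 / 2 := by
    rintro i ⟨x, hxA, hxS⟩
    have h1 : p i ∈ Metric.cthickening C S := by
      refine Metric.mem_cthickening_of_dist_le (p i) x C S hxS ?_
      rw [dist_comm]
      exact hC i hxA
    obtain ⟨y, hy, hd⟩ := mem_iUnion₂.mp (hcov h1)
    exact ⟨y, hy, hd⟩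
  choose! y hy hd using hmem
  refine Set.Finite.of_finite_image (f := y) (htf.subset ?_) ?_
  · rintro _ ⟨i, hi, rfl⟩
    exact hy i hi
  · intro i hi j hj hij
    by_contra hne
    have hA : y i ∈ A i := h.ball_subset i (by
      rw [Metric.mem_ball, dist_comm]
      exact hd i hi)
    have hA' : y i ∈ A j := h.ball_subset j (by
      rw [hij, Metric.mem_ball, dist_comm]
      exact hd j hj)
    exact disjoint_left.mp (h.disjoint i j hne) hA hA'

/-- A maximal `s`-separated set works: a point farther than `s` from all of it could be added. -/
theorem exists_separated_net (s : ℝ) (hs : 0 < s) :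
    ∃ N : Set X, (∀ x ∈ N, ∀ y ∈ N, x ≠ y → s ≤ dist x y) ∧ ∀ x, ∃ y ∈ N, dist x y ≤ s := by
  obtain ⟨N, hN⟩ := zorn_subset {N : Set X | ∀ x ∈ N, ∀ y ∈ N, x ≠ y → s ≤ dist x y} (by
    intro c hc hchain
    refine ⟨⋃₀ c, ?_, fun t ht => subset_sUnion_of_mem ht⟩
    rintro x ⟨t, ht, hx⟩ y ⟨t', ht', hy⟩ hxy
    rcases hchain.total ht ht' with h | h
    · exact hc ht' x (h hx) y hy hxy
    · exact hc ht x hx y (h hy) hxy)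
  refine ⟨N, hN.prop, fun x => ?_⟩
  by_contra! hx
  have hins : insert x N ∈ {N : Set X | ∀ x ∈ N, ∀ y ∈ N, x ≠ y → s ≤ dist x y} := by
    rintro a (rfl | ha) b (rfl | hb) hab
    · exact absurd rfl hab
    · exact (hx b hb).le
    · rw [dist_comm]
      exact (hx a ha).le
    · exact hN.prop a ha b hb hab
  have hxN : x ∈ N := hN.le_of_ge hins (subset_insert x N) (mem_insert x N)
  have := hx x hxN
  rw [dist_self] at this
  linarith

theorem IsUniformlyExpansive.exists_bound {f : X → Y} (hf : IsUniformlyExpansive f) (R : ℝ) :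
    ∃ S, 0 ≤ S ∧ ∀ x y, dist x y ≤ R → dist (f x) (f y) ≤ S := by
  obtain ⟨ρ, hm, hρ⟩ := hf
  refine ⟨ρ R.toNNReal, NNReal.coe_nonneg _, fun x y hxy => ?_⟩
  rw [← coe_nndist]
  refine NNReal.coe_le_coe.mpr ((hρ x y).trans (hm ?_))
  rw [← Real.toNNReal_coe (r := nndist x y), coe_nndist]
  exact Real.toNNReal_le_toNNReal hxy

/-- Distances between the points `q i` are controlled by those between the `p i`. -/
def ControlsDist {ι : Type*} (p : ι → X) (q : ι → Y) : Prop :=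
  ∀ R : ℝ, ∃ S : ℝ, ∀ i j, dist (p i) (p j) ≤ R → dist (q i) (q j) ≤ S

/-- With `s` such that `dist (f x) (f y) ≤ 1` forces `dist x y ≤ s`, an `(s + 1)`-separated net has
a 1-separated image. That image is a net in `Y` because `f ∘ g` is close to the identity. -/
theorem CoarselyEquivalent.exists_partitions [SecondCountableTopology X]
    (h : CoarselyEquivalent X Y) :
    ∃ (ι : Set X) (_ : Countable ι) (p : ι → X) (q : ι → Y) (A : ι → Set X) (B : ι → Set Y),
      IsBoundedPartition p A ∧ IsBoundedPartition q B ∧ ControlsDist p q ∧ ControlsDist q p := by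
  obtain ⟨f, ⟨hf, -⟩, g, ⟨hg, -⟩, ⟨c, hc, hfg⟩, ⟨d, hd, hgf⟩⟩ := h
  -- Compare `x` with `g (f x)` and `y` with `g (f y)`: expansiveness of `g` bounds the middle
  -- distance.
  have hlow : ∀ R, ∃ S, 0 ≤ S ∧ ∀ x y, dist (f x) (f y) ≤ R → dist x y ≤ S := by
    intro R
    obtain ⟨S, hS0, hS⟩ := hg.exists_bound R
    refine ⟨d + S + d, by positivity, fun x y hxy => ?_⟩
    have h1 := hgf x
    have h2 := hgf y
    simp only [Function.comp_apply, id_eq] at h1 h2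
    have h3 := dist_triangle4 x (g (f x)) (g (f y)) y
    rw [dist_comm x (g (f x))] at h3
    linarith [hS _ _ hxy]
  obtain ⟨s, hs0, hs⟩ := hlow 1
  obtain ⟨N, hN, hnet⟩ := exists_separated_net (X := X) (s + 1) (by positivity)
  have hpsep : ∀ i j : N, i ≠ j → 1 ≤ dist (i : X) j := fun i j hij =>
    (by linarith : 1 ≤ s + 1).trans (hN i i.2 j j.2 fun h => hij (Subtype.ext h))
  have hqsep : ∀ i j : N, i ≠ j → 1 ≤ dist (f i) (f j) := by
    intro i j hij
    by_contra! hlt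
    have h1 := hs _ _ hlt.le
    have h2 := hN i i.2 j j.2 fun h => hij (Subtype.ext h)
    linarith
  have hcount : Countable N := countable_of_separated hpsep
  obtain ⟨A, hA⟩ := exists_isBoundedPartition hpsep (C := s + 1) fun x => by
    obtain ⟨y, hy, hxy⟩ := hnet x
    exact ⟨⟨y, hy⟩, hxy⟩
  obtain ⟨S, hS0, hS⟩ := hf.exists_bound (s + 1)
  -- From `y` to `f (g y)` costs `c`; from there to `f x`, with `x` a net point within `s + 1` of `g
  -- y`, costs `S`.
  obtain ⟨B, hB⟩ := exists_isBoundedPartition hqsep (C := c + S) fun y => by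
    obtain ⟨x, hx, hxy⟩ := hnet (g y)
    refine ⟨⟨x, hx⟩, ?_⟩
    have h1 := hfg y
    simp only [Function.comp_apply, id_eq] at h1
    rw [dist_comm] at h1
    exact (dist_triangle y (f (g y)) (f x)).trans (add_le_add h1 (hS _ _ hxy))
  refine ⟨N, hcount, fun i => i, fun i => f i, A, B, hA, hB, fun R => ?_, fun R => ?_⟩
  · obtain ⟨S', -, hS'⟩ := hf.exists_bound R
    exact ⟨S', fun i j => hS' i j⟩
  · obtain ⟨S', -, hS'⟩ := hlow R
    exact ⟨S', fun i j => hS' i j⟩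

theorem coarselyEquivalent_refl : CoarselyEquivalent X X :=
  ⟨id, ⟨⟨id, monotone_id, fun _ _ => le_rfl⟩, fun _ h => h⟩, id,
    ⟨⟨id, monotone_id, fun _ _ => le_rfl⟩, fun _ h => h⟩,
    ⟨0, le_rfl, fun x => (dist_self x).le⟩, ⟨0, le_rfl, fun x => (dist_self x).le⟩⟩

end Geometry

/-! ### Conjugation by a unitary, also after tensoring with `K` -/

section Conj

variable {H : Type*} [NormedAddCommGroup H] [InnerProductSpace ℂ H] [CompleteSpace H]
variable {H' : Type*} [NormedAddCommGroup H'] [InnerProductSpace ℂ H'] [CompleteSpace H']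
variable (K : Type*) [NormedAddCommGroup K] [InnerProductSpace ℂ K] [CompleteSpace K]

/-- Conjugation by a unitary. -/
def conj (U : H ≃ₗᵢ[ℂ] H') (T : H →L[ℂ] H) : H' →L[ℂ] H' :=
  (U : H →L[ℂ] H').comp (T.comp (U.symm : H' →L[ℂ] H))

theorem conj_apply (U : H ≃ₗᵢ[ℂ] H') (T : H →L[ℂ] H) (η : H') : conj U T η = U (T (U.symm η)) :=
  rfl

theorem conj_mul (U : H ≃ₗᵢ[ℂ] H') (S T : H →L[ℂ] H) : conj U (S * T) = conj U S * conj U T := by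
  ext η
  simp [conj_apply, mul_apply_eq_comp]

theorem conj_add (U : H ≃ₗᵢ[ℂ] H') (S T : H →L[ℂ] H) : conj U (S + T) = conj U S + conj U T := by
  ext η
  simp [conj_apply]

theorem conj_smul (U : H ≃ₗᵢ[ℂ] H') (c : ℂ) (T : H →L[ℂ] H) : conj U (c • T) = c • conj U T := by
  ext η
  simp [conj_apply]

theorem conj_star (U : H ≃ₗᵢ[ℂ] H') (T : H →L[ℂ] H) : conj U (star T) = star (conj U T) := by
  rw [ContinuousLinearMap.star_eq_adjoint (conj U T), ContinuousLinearMap.eq_adjoint_iff]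
  intro x y
  rw [conj_apply, conj_apply, ContinuousLinearMap.star_eq_adjoint,
    LinearIsometryEquiv.inner_map_eq_flip, ContinuousLinearMap.adjoint_inner_left,
    LinearIsometryEquiv.inner_map_eq_flip, LinearIsometryEquiv.symm_symm]

theorem conj_symm_conj (U : H ≃ₗᵢ[ℂ] H') (T : H →L[ℂ] H) : conj U.symm (conj U T) = T := by
  ext η
  simp [conj_apply]

theorem conj_conj_symm (U : H ≃ₗᵢ[ℂ] H') (T : H' →L[ℂ] H') : conj U (conj U.symm T) = T := by
  ext η
  simp [conj_apply]

theorem conj_eq_of_intertwines {U : H ≃ₗᵢ[ℂ] H'} {P : H →L[ℂ] H} {Q : H' →L[ℂ] H'}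
    (h : ∀ ξ, U (P ξ) = Q (U ξ)) : conj U P = Q := by
  ext η
  rw [conj_apply, h, U.apply_symm_apply]

theorem IsCompactOperator.conj {T : H →L[ℂ] H} (hT : IsCompactOperator T) (U : H ≃ₗᵢ[ℂ] H') :
    IsCompactOperator (conj U T) :=
  (hT.comp_clm (U.symm : H' →L[ℂ] H)).clm_comp (U : H →L[ℂ] H')

/-- The operator `U ⊗ 1`. -/
def tensorIsometry (U : H ≃ₗᵢ[ℂ] H') : HilbertTensor H K →L[ℂ] HilbertTensor H' K :=
  (TensorProduct.mapIsometry U.toLinearIsometry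
    (LinearIsometry.id : K →ₗᵢ[ℂ] K)).toContinuousLinearMap.completion

variable {K}

theorem tensorIsometry_coe (U : H ≃ₗᵢ[ℂ] H') (z : H ⊗[ℂ] K) :
    tensorIsometry K U (toHilbertTensor z) =
      toHilbertTensor (TensorProduct.map U.toLinearIsometry.toLinearMap LinearMap.id z) :=
  ContinuousLinearMap.completion_apply_coe _ _

theorem norm_tensorIsometry_apply (U : H ≃ₗᵢ[ℂ] H') (z : HilbertTensor H K) :
    ‖tensorIsometry K U z‖ = ‖z‖ := by
  refine denseRange_toHilbertTensor.induction_on z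
    (isClosed_eq (by fun_prop) (by fun_prop)) fun z => ?_
  rw [tensorIsometry_coe, LinearIsometry.norm_map, LinearIsometry.norm_map]
  exact (TensorProduct.mapIsometry U.toLinearIsometry (LinearIsometry.id : K →ₗᵢ[ℂ] K)).norm_map z

theorem tensorIsometry_symm_apply (U : H ≃ₗᵢ[ℂ] H') (z : HilbertTensor H K) :
    tensorIsometry K U.symm (tensorIsometry K U z) = z := by
  refine denseRange_toHilbertTensor.induction_on z
    (isClosed_eq (by fun_prop) (by fun_prop)) fun z => ?_
  rw [tensorIsometry_coe, tensorIsometry_coe, ← LinearMap.comp_apply, ← TensorProduct.map_comp]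
  have h : U.symm.toLinearIsometry.toLinearMap ∘ₗ U.toLinearIsometry.toLinearMap =
      LinearMap.id := by
    ext ξ
    simp
  rw [h, LinearMap.id_comp, TensorProduct.map_id, LinearMap.id_apply]

variable (K) in
/-- The unitary `U ⊗ 1`. -/
def tensorUnitary (U : H ≃ₗᵢ[ℂ] H') : HilbertTensor H K ≃ₗᵢ[ℂ] HilbertTensor H' K where
  toLinearEquiv := LinearEquiv.ofLinearMap (tensorIsometry K U : HilbertTensor H K →ₗ[ℂ] _)
    (tensorIsometry K U.symm : HilbertTensor H' K →ₗ[ℂ] _)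
    (LinearMap.ext fun z => tensorIsometry_symm_apply U.symm z)
    (LinearMap.ext fun z => tensorIsometry_symm_apply U z)
  norm_map' := norm_tensorIsometry_apply U

theorem conj_tensorOp (U : H ≃ₗᵢ[ℂ] H') (T : H →L[ℂ] H) (B : K →L[ℂ] K) :
    conj (tensorUnitary K U) (tensorOp T B) = tensorOp (conj U T) B := by
  refine tensorOp_ext fun z => ?_
  change tensorIsometry K U (tensorOp T B (tensorIsometry K U.symm (toHilbertTensor z))) = _
  rw [tensorIsometry_coe, tensorOp_coe, tensorIsometry_coe, tensorOp_coe,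
    ← LinearMap.comp_apply, ← LinearMap.comp_apply, ← TensorProduct.map_comp,
    ← TensorProduct.map_comp]
  rfl

theorem norm_conj_le (U : H ≃ₗᵢ[ℂ] H') (T : H →L[ℂ] H) : ‖conj U T‖ ≤ ‖T‖ := by
  refine ContinuousLinearMap.opNorm_le_bound _ (norm_nonneg _) fun η => ?_
  rw [conj_apply, U.norm_map, ← U.symm.norm_map η]
  exact T.le_opNorm _

theorem conj_sub (U : H ≃ₗᵢ[ℂ] H') (S T : H →L[ℂ] H) : conj U (S - T) = conj U S - conj U T := by
  ext η
  simp [conj_apply]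

end Conj

/-! ### Step maps on a bounded partition -/

section Partition

variable {X : Type*} [MetricSpace X]
variable {K : Type*} [NormedAddCommGroup K] [InnerProductSpace ℂ K] [CompleteSpace K]
variable {ι : Type*} {p : ι → X} {A : ι → Set X}

/-- The piece that contains `x`. -/
def IsBoundedPartition.index (h : IsBoundedPartition p A) (x : X) : ι :=
  (mem_iUnion.mp (h.cover ▸ mem_univ x : x ∈ ⋃ i, A i)).choose

theorem IsBoundedPartition.mem_index (h : IsBoundedPartition p A) (x : X) : x ∈ A (h.index x) :=
  (mem_iUnion.mp (h.cover ▸ mem_univ x : x ∈ ⋃ i, A i)).choose_spec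

theorem IsBoundedPartition.index_eq (h : IsBoundedPartition p A) {x : X} {i : ι} (hx : x ∈ A i) :
    h.index x = i := by
  by_contra hne
  exact disjoint_left.mp (h.disjoint _ _ hne) (h.mem_index x) hx

/-- The family `A` reindexed by the natural numbers along `e`. -/
def natPieces (e : ι → ℕ) (A : ι → Set X) (n : ℕ) : Set X := ⋃ (i) (_ : e i = n), A i

theorem natPieces_apply {e : ι → ℕ} (he : Function.Injective e) (A : ι → Set X) (i : ι) :
    natPieces e A (e i) = A i := by
  ext x
  simp only [natPieces, mem_iUnion, exists_prop]
  exact ⟨fun ⟨j, hj, hx⟩ => he hj ▸ hx, fun hx => ⟨i, rfl, hx⟩⟩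

theorem natPieces_of_notMem {e : ι → ℕ} (A : ι → Set X) {n : ℕ} (hn : ¬ ∃ i, e i = n) :
    natPieces e A n = ∅ := by
  ext x
  simp only [natPieces, mem_iUnion, exists_prop, mem_empty_iff_false, iff_false]
  exact fun ⟨i, hi, _⟩ => hn ⟨i, hi⟩

/-- Indices outside the range of `e` carry the empty piece, so the default value 0 there is
harmless. -/
theorem IsBoundedPartition.isPartitionFor (h : IsBoundedPartition p A) {e : ι → ℕ}
    (he : Function.Injective e) (c : ι → Compacts K) :
    IsPartitionFor (fun x => c (h.index x)) (natPieces e A) (Function.extend e c 0) where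
  measurable n := by
    by_cases hn : ∃ i, e i = n
    · obtain ⟨i, rfl⟩ := hn
      rw [natPieces_apply he]
      exact h.measurable i
    · rw [natPieces_of_notMem A hn]
      exact @MeasurableSet.empty X (borel X)
  disjoint m n hmn := by
    rw [disjoint_left]
    intro x hx hx'
    simp only [natPieces, mem_iUnion, exists_prop] at hx hx'
    obtain ⟨i, rfl, hi⟩ := hx
    obtain ⟨j, rfl, hj⟩ := hx'
    exact hmn (by rw [← h.index_eq hi, ← h.index_eq hj])
  cover := eq_univ_of_forall fun x => mem_iUnion.mpr ⟨e (h.index x), by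
    rw [natPieces_apply he]
    exact h.mem_index x⟩
  value n x hx := by
    simp only [natPieces, mem_iUnion, exists_prop] at hx
    obtain ⟨i, rfl, hi⟩ := hx
    rw [h.index_eq hi, he.extend_apply]

end Partition

/-! ### Local compactness and ampleness in terms of pieces -/

section LocallyCompact

open scoped CompactlySupported

variable {X : Type*} [MetricSpace X] [ProperSpace X]
variable {H : Type*} [NormedAddCommGroup H] [InnerProductSpace ℂ H] [CompleteSpace H]
variable {ρ : C₀(X, ℂ) →⋆ₙₐ[ℂ] (H →L[ℂ] H)}
variable {ι : Type*} {p : ι → X} {A : ι → Set X}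

/-- In a proper space a bounded set has a compact closed 1-thickening. A compactly supported
function equal to 1 there is absorbed by `chi ρ E`. -/
theorem IsLocallyCompactOp.chi {T : H →L[ℂ] H} (hT : IsLocallyCompactOp ρ T) {E : Set X}
    (hE : Bornology.IsBounded E) :
    IsCompactOperator (chi ρ E * T : H →L[ℂ] H) ∧ IsCompactOperator (T * chi ρ E : H →L[ℂ] H) := by
  obtain ⟨f, hf1, hfc, -, -⟩ := exists_continuousMap_one_of_isCompact_subset_isOpen
    (Metric.isCompact_of_isClosed_isBounded Metric.isClosed_cthickening
      (hE.cthickening (δ := 1))) isOpen_univ (subset_univ _)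
  have hEU : E ⊆ Metric.thickening 1 E := Metric.self_subset_thickening one_pos E
  have h1 := map_mul_chi_eq_self ρ Metric.isOpen_thickening hEU (f := ofRealC0 ⟨f, hfc⟩)
    fun x hx => by
      rw [ofRealC0_apply]
      change ((f x : ℝ) : ℂ) = 1
      rw [hf1 (Metric.thickening_subset_cthickening 1 E hx)]
      simp
  have h2 : StrongQuasiLocal.chi ρ E * ρ (ofRealC0 ⟨f, hfc⟩) = StrongQuasiLocal.chi ρ E := by
    have := congrArg star h1
    rwa [star_mul, star_chi, star_map_ofRealC0] at this
  constructor
  · rw [← h2, mul_assoc]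
    exact (hT _).1.clm_comp (StrongQuasiLocal.chi ρ E)
  · rw [← h1, ← mul_assoc]
    exact (hT _).2.comp_clm (StrongQuasiLocal.chi ρ E)

/-- The functions of bounded support are dense. -/
theorem isCompactOperator_of_bounded_support (Φ : C₀(X, ℂ) → H →L[ℂ] H) (hΦ : Continuous Φ)
    (h : ∀ (f : C₀(X, ℂ)) (S : Set X), Bornology.IsBounded S → (∀ x ∉ S, f x = 0) →
      IsCompactOperator (Φ f)) (f : C₀(X, ℂ)) : IsCompactOperator (Φ f) := by
  obtain ⟨C, φ, hm, -, -, hS, h01, h1, -⟩ := exists_cutoffs (X := X) isOpen_univ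
  have hlim := tendsto_norm_cutoff_mul hm hS h01 h1 (f := f) fun x hx => absurd (mem_univ x) hx
  refine isCompactOperator_of_tendsto ((hΦ.tendsto f).comp hlim) (Eventually.of_forall fun n => ?_)
  refine h _ (tsupport (φ n)) (φ n).hasCompactSupport.isCompact.isBounded fun x hx => ?_
  change (φ n x : ℂ) * f x = 0
  rw [image_eq_zero_of_notMem_tsupport hx, Complex.ofReal_zero, zero_mul]

/-- If `f` has bounded support, only finitely many pieces meet it and `ρ f` is a finite sum of the
`chi ρ (A i) * ρ f`; density handles general `f`. -/
theorem isLocallyCompactOp_of_chi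
    (hρ : (Submodule.span ℂ {η : H | ∃ (f : C₀(X, ℂ)) (ξ : H), η = ρ f ξ}).topologicalClosure = ⊤)
    [Countable ι] (hA : IsBoundedPartition p A) {T : H →L[ℂ] H}
    (hT : ∀ i, IsCompactOperator (chi ρ (A i) * T : H →L[ℂ] H) ∧
      IsCompactOperator (T * chi ρ (A i) : H →L[ℂ] H)) : IsLocallyCompactOp ρ T := by
  have hres := isResolution_chi hρ hA.measurable hA.disjoint hA.cover
  have hsum : ∀ (f : C₀(X, ℂ)) (S : Set X), Bornology.IsBounded S → (∀ x ∉ S, f x = 0) →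
      ∃ s : Finset ι, ρ f = ∑ i ∈ s, chi ρ (A i) * ρ f := by
    intro f S hS hf
    refine ⟨(hA.finite_meet hS).toFinset, ?_⟩
    ext ξ
    refine (hres.hasSum (ρ f ξ)).unique ?_
    rw [sum_apply]
    refine hasSum_sum_of_ne_finset_zero fun i hi => ?_
    have h1 : chi ρ (A i)ᶜ * ρ f = ρ f := chi_mul_map ρ fun x hx => hf x fun hxS =>
      hi ((hA.finite_meet hS).mem_toFinset.mpr ⟨x, not_notMem.mp hx, hxS⟩)
    have h2 : chi ρ (A i) * chi ρ (A i)ᶜ = 0 :=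
      chi_mul_chi_of_disjoint hρ (@MeasurableSet.compl X (A i) (borel X) (hA.measurable i))
        disjoint_compl_right
    change (chi ρ (A i) * ρ f) ξ = 0
    rw [← h1, ← mul_assoc, h2, zero_mul, zero_apply]
  refine fun f => ⟨?_, ?_⟩
  · refine isCompactOperator_of_bounded_support (fun f => ρ f * T)
      ((continuous_map ρ).mul continuous_const) (fun f S hS hf => ?_) f
    -- Taking adjoints of the decomposition for `star f` puts the projections on the right of `ρ f`,
    -- next to `T`.
    obtain ⟨s, hs⟩ := hsum (star f) S hS fun x hx => by simp [hf x hx]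
    have h2 : ρ f = ∑ i ∈ s, ρ f * chi ρ (A i) := by
      have := congrArg star hs
      rw [map_star, star_star, star_sum] at this
      simpa only [star_mul, star_chi, star_star] using this
    rw [h2, Finset.sum_mul]
    refine Submodule.sum_mem (compactOperator (RingHom.id ℂ) H H) fun i _ => ?_
    rw [mul_assoc]
    exact (hT i).1.clm_comp (ρ f)
  · refine isCompactOperator_of_bounded_support (fun f => T * ρ f)
      (continuous_const.mul (continuous_map ρ)) (fun f S hS hf => ?_) f
    obtain ⟨s, hs⟩ := hsum f S hS hf
    rw [hs, Finset.mul_sum]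
    refine Submodule.sum_mem (compactOperator (RingHom.id ℂ) H H) fun i _ => ?_
    rw [← mul_assoc]
    exact (hT i).2.comp_clm (ρ f)

/-- In an ample module the projection of a set with interior points has infinite rank. -/
theorem IsAmpleModule.not_finiteDimensional_range (hρ : IsAmpleModule ρ) {E : Set X} {x : X}
    {r : ℝ} (hr : 0 < r) (hE : Metric.ball x r ⊆ E) :
    ¬ FiniteDimensional ℂ (LinearMap.range (chi ρ E : H →ₗ[ℂ] H)) := by
  intro hfin
  -- A nonzero bump `φ n` supported in the ball satisfies `chi ρ E * ρ(φ n) = ρ(φ n)`; finite rank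
  -- of `chi ρ E` would make this compact, against ampleness.
  obtain ⟨C, φ, -, -, -, hS, -, h1, h0⟩ := exists_cutoffs (Metric.isOpen_ball (x := x) (ε := r))
  obtain ⟨n, hn⟩ := hS {x} (singleton_subset_iff.mpr (Metric.mem_ball_self hr)) isCompact_singleton
  refine hρ.ample (ofRealC0 (φ n)) (fun h => ?_) ?_
  · have h2 : ofRealC0 (φ n) x = 0 := by rw [h]; rfl
    rw [ofRealC0_apply, h1 n x (hn rfl)] at h2
    simp at h2
  · have h2 : chi ρ E * ρ (ofRealC0 (φ n)) = ρ (ofRealC0 (φ n)) := chi_mul_map ρ fun y hy => by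
      rw [ofRealC0_apply, h0 n y fun h => hy (hE h), Complex.ofReal_zero]
    have h3 : IsCompactOperator (chi ρ E) := by
      have : ProperSpace (LinearMap.range (chi ρ E : H →ₗ[ℂ] H)) := FiniteDimensional.proper ℂ _
      let S := (chi ρ E).codRestrict (LinearMap.range (chi ρ E : H →ₗ[ℂ] H)) fun ξ => ⟨ξ, rfl⟩
      have hS : IsCompactOperator S := isCompactOperator_of_locallyCompactSpace_dom S
      exact hS.clm_comp
        (LinearMap.range (chi ρ E : H →ₗ[ℂ] H)).subtypeL
    rw [← h2]
    exact h3.comp_clm (ρ (ofRealC0 (φ n)))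

end LocallyCompact

/-! ### Transfer of the algebra along matched partitions -/

section Transfer

variable {X Y : Type*} [MetricSpace X] [ProperSpace X] [MetricSpace Y] [ProperSpace Y]
variable {H : Type*} [NormedAddCommGroup H] [InnerProductSpace ℂ H] [CompleteSpace H]
variable {H' : Type*} [NormedAddCommGroup H'] [InnerProductSpace ℂ H'] [CompleteSpace H']
variable {K : Type*} [NormedAddCommGroup K] [InnerProductSpace ℂ K] [CompleteSpace K]
variable {ρ : C₀(X, ℂ) →⋆ₙₐ[ℂ] (H →L[ℂ] H)} {ρ' : C₀(Y, ℂ) →⋆ₙₐ[ℂ] (H' →L[ℂ] H')}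
variable {ι : Type*} [Countable ι] {p : ι → X} {q : ι → Y} {A : ι → Set X} {B : ι → Set Y}

theorem IsLocallyCompactOp.conj
    (hρ' : (Submodule.span ℂ
      {η : H' | ∃ (f : C₀(Y, ℂ)) (ξ : H'), η = ρ' f ξ}).topologicalClosure = ⊤)
    (hA : IsBoundedPartition p A) (hB : IsBoundedPartition q B) {U : H ≃ₗᵢ[ℂ] H'}
    (hU : ∀ i ξ, U (StrongQuasiLocal.chi ρ (A i) ξ) = StrongQuasiLocal.chi ρ' (B i) (U ξ))
    {T : H →L[ℂ] H} (hT : IsLocallyCompactOp ρ T) :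
    IsLocallyCompactOp ρ' (StrongQuasiLocal.conj U T) := by
  refine isLocallyCompactOp_of_chi hρ' hB fun i => ?_
  obtain ⟨C, hC⟩ := hA.bounded
  obtain ⟨h1, h2⟩ := hT.chi (Metric.isBounded_closedBall.subset (hC i))
  rw [← conj_eq_of_intertwines (hU i), ← conj_mul, ← conj_mul]
  exact ⟨IsCompactOperator.conj h1 U, IsCompactOperator.conj h2 U⟩

/-- A unitary that matches two partitions carries the operator `Λ` of a map that is constant on
the pieces of the first to that of the corresponding map for the second. -/
theorem exists_isLambda_step
    (hρ : (Submodule.span ℂ {η : H | ∃ (f : C₀(X, ℂ)) (ξ : H), η = ρ f ξ}).topologicalClosure = ⊤)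
    (hA : IsBoundedPartition p A) (hB : IsBoundedPartition q B) {U : H ≃ₗᵢ[ℂ] H'}
    (hU : ∀ i ξ, U (chi ρ (A i) ξ) = chi ρ' (B i) (U ξ)) (c : ι → Compacts K) {M : ℝ}
    (hc : ∀ i, ‖c i‖ ≤ M) :
    ∃ L, IsLambda ρ (fun x => c (hA.index x)) L ∧
      IsLambda ρ' (fun y => c (hB.index y)) (conj (tensorUnitary K U) L) := by
  obtain ⟨e, he⟩ := exists_injective_nat ι
  have hPA := hA.isPartitionFor he c
  obtain ⟨L, hL⟩ := exists_blockDiagonal_chi hρ hPA (C := M) fun x => hc _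
  refine ⟨L, IsLambdaCountable.isLambda ⟨_, _, hPA, hL⟩,
    IsLambdaCountable.isLambda ⟨_, _, hB.isPartitionFor he c, fun n => ?_⟩⟩
  have hchi : chi ρ' (natPieces e B n) = conj U (chi ρ (natPieces e A n)) := by
    by_cases hn : ∃ i, e i = n
    · obtain ⟨i, rfl⟩ := hn
      rw [natPieces_apply he, natPieces_apply he, conj_eq_of_intertwines (hU i)]
    · rw [natPieces_of_notMem _ hn, natPieces_of_notMem _ hn, chi_empty, chi_empty]
      ext η
      simp [conj_apply]
  rw [hchi, ← conj_tensorOp, ← conj_tensorOp, ← conj_mul, ← conj_mul, (hL n).1, (hL n).2]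
  exact ⟨rfl, rfl⟩

/-- The commutator with `Λ(g)` is that with `Λ` of the step map `g (q i)` on `B i`, up to an error
`2‖T'‖δ`. Pulled back by `U`, it becomes a commutator of `T` with `Λ` of a step map on `X`. -/
theorem IsStronglyQuasiLocal.conj
    (hρ : (Submodule.span ℂ {η : H | ∃ (f : C₀(X, ℂ)) (ξ : H), η = ρ f ξ}).topologicalClosure = ⊤)
    (hρ' : (Submodule.span ℂ
      {η : H' | ∃ (f : C₀(Y, ℂ)) (ξ : H'), η = ρ' f ξ}).topologicalClosure = ⊤)
    (hA : IsBoundedPartition p A) (hB : IsBoundedPartition q B) (hpq : ControlsDist p q)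
    {U : H ≃ₗᵢ[ℂ] H'}
    (hU : ∀ i ξ, U (StrongQuasiLocal.chi ρ (A i) ξ) = StrongQuasiLocal.chi ρ' (B i) (U ξ))
    {T : H →L[ℂ] H} (hT : IsStronglyQuasiLocal K ρ T) :
    IsStronglyQuasiLocal K ρ' (StrongQuasiLocal.conj U T) := by
  intro ε hε
  obtain ⟨δ₀, hδ₀, R₀, -, hT⟩ := hT (ε / 2) (by positivity)
  obtain ⟨C, hC⟩ := hA.bounded
  obtain ⟨D, hD⟩ := hB.bounded
  -- Points of `X` at distance below `R₀` lie in pieces with base points at most `C + R₀ + C` apart.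
  obtain ⟨S, hS⟩ := hpq (C + R₀ + C)
  set T' := tensorOp (StrongQuasiLocal.conj U T) (1 : K →L[ℂ] K) with hT'
  -- The second bound keeps the replacement error `2‖T'‖δ` within `ε / 2`.
  set δ := min δ₀ (ε / (4 * (‖T'‖ + 1))) with hδ
  have hδpos : 0 < δ := lt_min hδ₀ (by positivity)
  -- This radius strictly exceeds `S`, for the variation of the step map on `X`, and `D`, for the
  -- distance from a point of `Y` to its base point.
  refine ⟨δ, hδpos, max (max S D) 0 + 1, by positivity, fun g hg hg1 hv => ?_⟩
  obtain ⟨L, hL, hL'⟩ := exists_isLambda_step (K := K) hρ hA hB hU (fun i => g (q i))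
    (M := 1) fun i => hg1 _
  have hcomm : ‖T' * StrongQuasiLocal.conj (tensorUnitary K U) L -
      StrongQuasiLocal.conj (tensorUnitary K U) L * T'‖ < ε / 2 := by
    have h1 : IsStronglyMeasurable fun x => g (q (hA.index x)) := by
      obtain ⟨e, he⟩ := exists_injective_nat ι
      exact ⟨fun _ x => g (q (hA.index x)),
        fun _ => ⟨_, _, hA.isPartitionFor he fun i => g (q i)⟩, fun _ => tendsto_const_nhds⟩
    have h2 : HasVariation (fun x => g (q (hA.index x))) δ₀ R₀ := by
      intro x y hxy
      refine (hv _ _ ?_).trans_le (min_le_left _ _)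
      refine (hS _ _ ?_).trans_lt ?_
      · have h3 := hC _ (hA.mem_index x)
        have h4 := hC _ (hA.mem_index y)
        rw [Metric.mem_closedBall] at h3 h4
        rw [dist_comm] at h3
        have := dist_triangle4 (p (hA.index x)) x y (p (hA.index y))
        linarith
      · linarith [le_max_left (max S D) 0, le_max_left S D]
    have h3 := hT _ h1 (fun x => hg1 _) h2
    rw [hL.lambda_eq hρ] at h3
    rw [hT', ← conj_tensorOp, ← conj_mul, ← conj_mul, ← conj_sub]
    exact (norm_conj_le _ _).trans_lt h3
  obtain ⟨G, hG⟩ := exists_isLambda hρ' hg hg1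
  have hGL : ‖G - StrongQuasiLocal.conj (tensorUnitary K U) L‖ ≤ δ := by
    refine hG.norm_sub_le hρ' hL' hδpos.le fun y => (hv _ _ ?_).le
    have h3 := hD _ (hB.mem_index y)
    rw [Metric.mem_closedBall] at h3
    linarith [le_max_left (max S D) 0, le_max_right S D]
  rw [hG.lambda_eq hρ']
  set L' := StrongQuasiLocal.conj (tensorUnitary K U) L
  have hsplit : T' * G - G * T' = (T' * L' - L' * T') + (T' * (G - L') - (G - L') * T') := by
    noncomm_ring
  have h1 : ‖T' * (G - L') - (G - L') * T'‖ ≤ 2 * (‖T'‖ * δ) := by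
    refine (norm_sub_le _ _).trans ?_
    have a1 : ‖T' * (G - L')‖ ≤ ‖T'‖ * δ := (norm_mul_le _ _).trans (by gcongr)
    have a2 : ‖(G - L') * T'‖ ≤ δ * ‖T'‖ := (norm_mul_le _ _).trans (by gcongr)
    linarith
  have h2 : 2 * (‖T'‖ * δ) ≤ ε / 2 := by
    have a1 : δ ≤ ε / (4 * (‖T'‖ + 1)) := min_le_right _ _
    rw [le_div_iff₀ (by positivity)] at a1
    nlinarith [norm_nonneg T']
  rw [hsplit]
  refine (norm_add_le _ _).trans_lt ?_
  linarith

variable (K) in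
/-- Matching partitions of two ample modules yield isomorphic strongly quasi-local algebras. -/
theorem nonempty_starAlgEquiv (hρ : IsAmpleModule ρ) (hρ' : IsAmpleModule ρ')
    (hA : IsBoundedPartition p A) (hB : IsBoundedPartition q B) (hpq : ControlsDist p q)
    (hqp : ControlsDist q p) :
    Nonempty (strongQuasiLocalAlgebra K ρ ≃⋆ₐ[ℂ] strongQuasiLocalAlgebra K ρ') := by
  have hP := isResolution_chi hρ.nondegenerate hA.measurable hA.disjoint hA.cover
  have hQ := isResolution_chi hρ'.nondegenerate hB.measurable hB.disjoint hB.cover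
  have := hρ.separable
  have := hρ'.separable
  obtain ⟨U, hU⟩ := hP.exists_unitary hQ
    (fun i => hρ.not_finiteDimensional_range (by norm_num) (hA.ball_subset i))
    (fun i => hρ'.not_finiteDimensional_range (by norm_num) (hB.ball_subset i))
  have hU' : ∀ i ξ, U.symm (chi ρ' (B i) ξ) = chi ρ (A i) (U.symm ξ) := by
    intro i ξ
    rw [LinearIsometryEquiv.symm_apply_eq, hU, U.apply_symm_apply]
  exact ⟨{
    toFun T := ⟨conj U T.1, T.2.1.conj hρ'.nondegenerate hA hB hU,
      T.2.2.conj hρ.nondegenerate hρ'.nondegenerate hA hB hpq hU⟩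
    invFun T := ⟨conj U.symm T.1, T.2.1.conj hρ.nondegenerate hB hA hU',
      T.2.2.conj hρ'.nondegenerate hρ.nondegenerate hB hA hqp hU'⟩
    left_inv T := Subtype.ext (conj_symm_conj U T.1)
    right_inv T := Subtype.ext (conj_conj_symm U T.1)
    map_mul' S T := Subtype.ext (conj_mul U S.1 T.1)
    map_add' S T := Subtype.ext (conj_add U S.1 T.1)
    map_star' T := Subtype.ext (conj_star U T.1)
    map_smul' c T := Subtype.ext (conj_smul U c T.1) }⟩

variable (K) in
theorem CoarselyEquivalent.nonempty_starAlgEquiv (h : CoarselyEquivalent X Y)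
    (hρ : IsAmpleModule ρ) (hρ' : IsAmpleModule ρ') :
    Nonempty (strongQuasiLocalAlgebra K ρ ≃⋆ₐ[ℂ] strongQuasiLocalAlgebra K ρ') := by
  obtain ⟨ι, _, p, q, A, B, hA, hB, hpq, hqp⟩ := h.exists_partitions
  exact StrongQuasiLocal.nonempty_starAlgEquiv K hρ hρ' hA hB hpq hqp

end Transfer

end StrongQuasiLocal

end

theorem mainTheorem6
    (K : Type*) [NormedAddCommGroup K] [InnerProductSpace ℂ K] [CompleteSpace K]
    [TopologicalSpace.SeparableSpace K] (hK : ¬ FiniteDimensional ℂ K) :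
    (∀ (X : Type*) [MetricSpace X] [ProperSpace X]
        (Y : Type*) [MetricSpace Y] [ProperSpace Y]
        (HX : Type*) [NormedAddCommGroup HX] [InnerProductSpace ℂ HX] [CompleteSpace HX]
        (HY : Type*) [NormedAddCommGroup HY] [InnerProductSpace ℂ HY] [CompleteSpace HY]
        (ρX : C₀(X, ℂ) →⋆ₙₐ[ℂ] (HX →L[ℂ] HX)) (ρY : C₀(Y, ℂ) →⋆ₙₐ[ℂ] (HY →L[ℂ] HY)),
        StrongQuasiLocal.HasBoundedGeometry X → StrongQuasiLocal.HasBoundedGeometry Y →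
        StrongQuasiLocal.IsAmpleModule ρX → StrongQuasiLocal.IsAmpleModule ρY →
        StrongQuasiLocal.CoarselyEquivalent X Y →
        Nonempty (StrongQuasiLocal.strongQuasiLocalAlgebra K ρX ≃⋆ₐ[ℂ]
          StrongQuasiLocal.strongQuasiLocalAlgebra K ρY)) ∧
    (∀ (X : Type*) [MetricSpace X] [ProperSpace X]
        (H : Type*) [NormedAddCommGroup H] [InnerProductSpace ℂ H] [CompleteSpace H]
        (H' : Type*) [NormedAddCommGroup H'] [InnerProductSpace ℂ H'] [CompleteSpace H']
        (ρ : C₀(X, ℂ) →⋆ₙₐ[ℂ] (H →L[ℂ] H)) (ρ' : C₀(X, ℂ) →⋆ₙₐ[ℂ] (H' →L[ℂ] H')),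
        StrongQuasiLocal.HasBoundedGeometry X →
        StrongQuasiLocal.IsAmpleModule ρ → StrongQuasiLocal.IsAmpleModule ρ' →
        Nonempty (StrongQuasiLocal.strongQuasiLocalAlgebra K ρ ≃⋆ₐ[ℂ]
          StrongQuasiLocal.strongQuasiLocalAlgebra K ρ')) := by
  exact ⟨fun X _ _ Y _ _ HX _ _ _ HY _ _ _ ρX ρY _ _ hρX hρY h =>
      h.nonempty_starAlgEquiv K hρX hρY,
    fun X _ _ H _ _ _ H' _ _ _ ρ ρ' _ hρ hρ' =>
      StrongQuasiLocal.coarselyEquivalent_refl.nonempty_starAlgEquiv K hρ hρ'⟩
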